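/- Let $\beta>1$, let $T_\beta(x)=\beta x-\lfloor\beta x\rfloor$ on $[0,1)$, and for $x\in[0,1)$ let $\varepsilon_n(x)=\lfloor\beta T_\beta^{n-1}(x)\rfloor$, $n\ge1$, be the digits of its $\beta$-expansion. For $y\in[0,1)$ let $I_n(y)=\{z\in[0,1):\varepsilon_i(z)=\varepsilon_i(y),\ 1\le i\le n\}$, and for $x,y\in[0,1)$ let \[W_n^\beta(x,y)=\inf\{k\ge1:\ T_\beta^kx\in I_n(y)\}\in\{1,2,\dots\}\cup\{\infty\},\] with $\inf\emptyset=\infty$ and $\log\infty=\infty$. An accumulation point of the sequence $\big(\tfrac1n\log W_n^\beta(x,y)\big)_{n\ge1}$ is a point of $[-\infty,\infty]$ every neighbourhood of which contains infinitely many terms of the sequence (counted by index). Theorem. Let $J\subset(0,\infty)$ be a non-empty interval that is closed in $\mathbb R$, that is, $J=[a,b]$ with $0<a\le b<\infty$ or $J=[a,\infty)$ with $a>0$. Then the set \[\Big\{(x,y)\in[0,1)^2:\ \text{the set of real accumulation points of } \tfrac1n\log W_n^\beta(x,y)\text{ equals }J\Big\}\] has Hausdorff dimension $2$. If $J$ is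 bounded, then also the set of those $(x,y)\in[0,1)^2$ for which the set of all accumulation points in $[-\infty,\infty]$ equals $J$ (so that $\infty$ is not an accumulation point) has Hausdorff dimension $2$. -/

import Mathlib

open Set Filter

namespace BetaExpansion

noncomputable section

/-- The `β`-transformation `x ↦ βx - [βx]` (considered on `[0,1)`). -/
def T (β : ℝ) (x : ℝ) : ℝ := β * x - ⌊β * x⌋

/-- The `n`-th digit `[β T^{n-1} x]` of the `β`-expansion of `x`, for `n ≥ 1`. -/
def digit (β : ℝ) (x : ℝ) (n : ℕ) : ℤ := ⌊β * (T β)^[n - 1] x⌋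

/-- The basic interval `I_n(y)` of order `n` containing `y`: the points of `[0,1)` that have
the same first `n` digits as `y`. -/
def basicInterval (β : ℝ) (n : ℕ) (y : ℝ) : Set ℝ :=
  {z | z ∈ Ico (0 : ℝ) 1 ∧ ∀ i, 1 ≤ i → i ≤ n → digit β z i = digit β y i}

/-- The waiting time `inf {k ≥ 1 : T^k x ∈ I_n(y)}`, equal to `⊤` if there is no such `k`. -/
def waitingTime (β : ℝ) (n : ℕ) (x y : ℝ) : ℕ∞ :=
  ⨅ (k : ℕ) (_ : 1 ≤ k ∧ (T β)^[k] x ∈ basicInterval β n y), (k : ℕ∞)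

/-- The number `(1/n) log W_n(x,y)`, equal to `⊤` if the waiting time is infinite. -/
def waitingRate (β : ℝ) (x y : ℝ) (n : ℕ) : EReal :=
  ENNReal.log (waitingTime β n x y : ENNReal) / (n : EReal)

/-- The accumulation points, in the extended real line, of the sequence `(1/n) log W_n(x,y)`. -/
def accPoints (β : ℝ) (x y : ℝ) : Set EReal :=
  {t | MapClusterPt t atTop (waitingRate β x y)}

/-- The pairs in `[0,1)²` for which the set of real accumulation points of `(1/n) log W_n(x,y)`
is `J`. -/
def accLevelSet (β : ℝ) (J : Set ℝ) : Set (ℝ × ℝ) :=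
  {p | p.1 ∈ Ico (0 : ℝ) 1 ∧ p.2 ∈ Ico (0 : ℝ) 1 ∧
    {t : ℝ | (t : EReal) ∈ accPoints β p.1 p.2} = J}

/-- The pairs in `[0,1)²` for which the set of all accumulation points of `(1/n) log W_n(x,y)`
in the extended real line is `J` (so that `∞` is not one of them). -/
def extAccLevelSet (β : ℝ) (J : Set ℝ) : Set (ℝ × ℝ) :=
  {p | p.1 ∈ Ico (0 : ℝ) 1 ∧ p.2 ∈ Ico (0 : ℝ) 1 ∧
    accPoints β p.1 p.2 = (fun t : ℝ => (t : EReal)) '' J}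

end

end BetaExpansion

/-! Points are coded by concatenating letters: left endpoints of full intervals of a fixed large
order `m`. Full intervals can be followed by one another freely, and `pow_le_card_isFull` gives at
least `β ^ m / (m + 1)` of them, so for every `r < 1` a suitable `m` provides at least `β ^ (m r)`
nonzero letters (`eventually_exists_letters`).

The blocks of `y` are four zero letters followed by an arbitrary sequence `v` of nonzero letters.
The blocks of `x` form an arbitrary sequence `u` of nonzero letters into which, at place `P l`, the
first `l` blocks of `y` and a closing `0` are inserted. A long prefix of `y` can be found in `x`
only at an insertion, because only there does the zero marker occur, and the closing `0` limits how
much of `y` is matched. Hence `W_n(x,y)` lies between `m P(⌊n/m⌋)` and `m P(⌊n/m⌋ + 1)`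
(`waitingTime_bounds`).

With `P l = ⌊exp (m l h(l))⌋` the rate `(1/n) log W_n` differs from `h(⌊n/m⌋)` by a null sequence,
provided `h` varies slowly. A slow `h` with values in `J` that accumulates at every point of `J` is
a clamped oscillation in `log n` (`exists_slow_sequence`).

The places `P l` grow exponentially, so insertions have density zero and cost no dimension: reading
`u` and `v` back as base-`q` expansions, `q` being the number of letters, is Hölder of exponent `r`
on the set of coded pairs and maps onto a set containing the unit square (`le_dimH_insertionSet`).
The dimension is thus at least `2 r` for every `r < 1`. -/

namespace BetaExpansion

/-! ### Full basic intervals and their concatenation -/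

/-- The digit sequence of the `β`-expansion of `x`, indexed from `0`. -/
noncomputable def digitSeq (β x : ℝ) (i : ℕ) : ℤ := ⌊β * (T β)^[i] x⌋

/-- `c` is the left endpoint of a full basic interval of order `n`. -/
def IsFull (β : ℝ) (n : ℕ) (c : ℝ) : Prop :=
  ∀ t ∈ Ico (0 : ℝ) 1, c + t / β ^ n ∈ Ico (0 : ℝ) 1 ∧ (T β)^[n] (c + t / β ^ n) = t ∧
    ∀ i < n, digitSeq β (c + t / β ^ n) i = digitSeq β c i

variable {β : ℝ}

lemma T_eq_fract (x : ℝ) : T β x = Int.fract (β * x) := rfl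

lemma T_mem (x : ℝ) : T β x ∈ Ico (0 : ℝ) 1 := ⟨Int.fract_nonneg _, Int.fract_lt_one _⟩

lemma iterate_T_mem {x : ℝ} (hx : x ∈ Ico (0 : ℝ) 1) (n : ℕ) :
    (T β)^[n] x ∈ Ico (0 : ℝ) 1 := by
  cases n with
  | zero => exact hx
  | succ n => rw [Function.iterate_succ_apply']; exact T_mem _

lemma digitSeq_iterate (x : ℝ) (k i : ℕ) :
    digitSeq β ((T β)^[k] x) i = digitSeq β x (k + i) := by
  rw [digitSeq, digitSeq, add_comm k i, Function.iterate_add_apply]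

lemma iterate_T_succ_eq (x : ℝ) (n : ℕ) :
    (T β)^[n + 1] x = β * (T β)^[n] x - digitSeq β x n := by
  rw [Function.iterate_succ_apply']; rfl

/-- A point with `n` leading zero digits is expanded linearly by the first `n` iterates. -/
lemma iterate_T_of_digitSeq_eq_zero {x : ℝ} {n : ℕ} (h : ∀ i < n, digitSeq β x i = 0) :
    (T β)^[n] x = β ^ n * x := by
  induction n with
  | zero => simp
  | succ n ih =>
    rw [iterate_T_succ_eq, h n n.lt_succ_self, ih fun i hi => h i (by omega)]
    push_cast; ring

lemma IsFull.self {n : ℕ} {c : ℝ} (h : IsFull β n c) :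
    c ∈ Ico (0 : ℝ) 1 ∧ (T β)^[n] c = 0 := by
  have := h 0 (by simp)
  simp only [zero_div, add_zero] at this
  exact ⟨this.1, this.2.1⟩

lemma IsFull.add_inv_le_one (hβ : 0 < β) {n : ℕ} {c : ℝ} (h : IsFull β n c) :
    c + 1 / β ^ n ≤ 1 := by
  have hb : 0 < β ^ n := by positivity
  by_contra! hc
  have h1 : (1 - c) * β ^ n < 1 := by
    rw [← sub_lt_iff_lt_add', lt_div_iff₀ hb] at hc; exact hc
  have h0 := (h.self).1
  have := (h ((1 - c) * β ^ n) ⟨by have := h0.2; nlinarith, h1⟩).1.2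
  rw [mul_div_assoc, div_self hb.ne'] at this
  linarith

lemma isFull_zero (c : ℝ) (hc : c = 0) : IsFull β 0 c := by
  subst hc
  intro t ht
  simpa using ht

lemma IsFull.comp (hβ : 0 < β) {n k : ℕ} {c d : ℝ} (hc : IsFull β n c) (hd : IsFull β k d) :
    IsFull β (n + k) (c + d / β ^ n) := by
  have hb : β ^ n ≠ 0 := by positivity
  have hk : β ^ k ≠ 0 := by positivity
  intro t ht
  have e : c + d / β ^ n + t / β ^ (n + k) = c + (d + t / β ^ k) / β ^ n := by
    rw [pow_add]; field_simp; ring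
  obtain ⟨hs, hT, hD⟩ := hd t ht
  obtain ⟨hs', hT', hD'⟩ := hc _ hs
  obtain ⟨-, hT0, hD0⟩ := hc d (hd.self).1
  rw [e]
  refine ⟨hs', by rw [add_comm n k, Function.iterate_add_apply, hT', hT], fun i hi => ?_⟩
  rcases lt_or_ge i n with h | h
  · rw [hD' i h, hD0 i h]
  · obtain ⟨j, rfl⟩ := Nat.exists_eq_add_of_le h
    rw [← digitSeq_iterate, ← digitSeq_iterate, hT', hT0, hD j (by omega)]

lemma isFull_one_zero (hβ : 1 < β) : IsFull β 1 0 := by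
  have h0 : 0 < β := by linarith
  intro t ht
  have e : β * (0 + t / β ^ 1) = t := by field_simp; ring
  refine ⟨⟨by have := ht.1; positivity, ?_⟩, ?_, fun i hi => ?_⟩
  · rw [zero_add, pow_one, div_lt_one h0]; linarith [ht.2]
  · rw [Function.iterate_one, T_eq_fract, e]; exact Int.fract_eq_self.2 ht
  · obtain rfl : i = 0 := by omega
    simp only [digitSeq, Function.iterate_zero, id]
    rw [e]; simp [Int.floor_eq_iff, ht.1, ht.2]

lemma isFull_zero_right (hβ : 1 < β) (n : ℕ) : IsFull β n 0 := by
  induction n with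
  | zero => exact isFull_zero 0 rfl
  | succ n ih => simpa using ih.comp (by linarith) (isFull_one_zero hβ)

lemma IsFull.mono (hβ : 1 < β) {n k : ℕ} {c : ℝ} (hc : IsFull β n c) (h : n ≤ k) :
    IsFull β k c := by
  obtain ⟨j, rfl⟩ := Nat.exists_eq_add_of_le h
  simpa using hc.comp (by linarith) (isFull_zero_right hβ j)

/-- A point strictly inside the interval of `c` has nonzero image under the `n`-th iterate, whereas
the left endpoint `d` is sent to `0`. -/
lemma IsFull.add_inv_le (hβ : 0 < β) {n : ℕ} {c d : ℝ} (hc : IsFull β n c) (hd : IsFull β n d)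
    (h : c < d) : c + 1 / β ^ n ≤ d := by
  have hb : 0 < β ^ n := by positivity
  by_contra! hlt
  have ht : (d - c) * β ^ n ∈ Ico (0 : ℝ) 1 := by
    refine ⟨by nlinarith, ?_⟩
    rw [← sub_lt_iff_lt_add', lt_div_iff₀ hb] at hlt; exact hlt
  have := (hc _ ht).2.1
  rw [mul_div_assoc, div_self hb.ne', mul_one, add_sub_cancel, (hd.self).2] at this
  nlinarith

/-! ### Counting full intervals through the expansion of `1` -/

/-- Left endpoint of the last basic interval of order `n`. -/
noncomputable def lastPoint (β : ℝ) (n : ℕ) : ℝ := 1 - (T β)^[n] 1 / β ^ n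

lemma lastPoint_zero : lastPoint β 0 = 0 := by simp [lastPoint]

lemma iterate_T_one_mem (n : ℕ) : (T β)^[n] 1 ∈ Icc (0 : ℝ) 1 := by
  cases n with
  | zero => simp
  | succ n => rw [Function.iterate_succ_apply']; exact Ico_subset_Icc_self (T_mem _)

lemma lastPoint_succ (hβ : 0 < β) (n : ℕ) :
    lastPoint β (n + 1) = lastPoint β n + digitSeq β 1 n / β ^ (n + 1) := by
  have : β ^ n ≠ 0 := by positivity
  rw [lastPoint, lastPoint, iterate_T_succ_eq, pow_succ]; field_simp; ring

lemma lastPoint_add (hβ : 1 < β) (n : ℕ) {u : ℝ} (hu : 0 ≤ u) (h : u < (T β)^[n] 1) :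
    lastPoint β n + u / β ^ n ∈ Ico (0 : ℝ) 1 ∧ (T β)^[n] (lastPoint β n + u / β ^ n) = u ∧
      ∀ i < n, digitSeq β (lastPoint β n + u / β ^ n) i = digitSeq β 1 i := by
  have h0 : 0 < β := by linarith
  induction n generalizing u with
  | zero =>
    simp only [Function.iterate_zero, id] at h
    simp [lastPoint_zero, hu, h]
  | succ n ih =>
    have hlt : u < 1 := h.trans_le (iterate_T_one_mem _).2
    have hd : (0 : ℝ) ≤ digitSeq β 1 n := by
      have : 0 ≤ digitSeq β 1 n :=
        Int.floor_nonneg.2 (mul_nonneg h0.le (iterate_T_one_mem _).1)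
      exact_mod_cast this
    rw [iterate_T_succ_eq] at h
    have e : lastPoint β (n + 1) + u / β ^ (n + 1) =
        lastPoint β n + ((digitSeq β 1 n + u) / β) / β ^ n := by
      rw [lastPoint_succ h0, pow_succ]; field_simp; ring
    have hu' : (digitSeq β 1 n + u) / β < (T β)^[n] 1 := by
      rw [div_lt_iff₀ h0]; linarith
    obtain ⟨h1, h2, h3⟩ := ih (by positivity) hu'
    have hfl : ⌊(digitSeq β 1 n : ℝ) + u⌋ = digitSeq β 1 n := by
      simp [Int.floor_eq_iff, hu, hlt]
    have e2 : β * ((digitSeq β 1 n + u) / β) = digitSeq β 1 n + u := by field_simp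
    rw [e]
    refine ⟨h1, ?_, fun i hi => ?_⟩
    · rw [Function.iterate_succ_apply', h2, T, e2, hfl]; ring
    · rcases Nat.lt_succ_iff_lt_or_eq.1 hi with hi | rfl
      · exact h3 i hi
      · rw [digitSeq, h2, e2, hfl]

/-- Once a digit drops strictly below the corresponding digit of `1`, the expansion is free again:
`(i + t) / β < T^n 1` for all `t < 1`. -/
lemma isFull_lastPoint_add (hβ : 1 < β) (n : ℕ) {i : ℤ} (hi : 0 ≤ i) (h : i < digitSeq β 1 n) :
    IsFull β (n + 1) (lastPoint β n + i / β ^ (n + 1)) := by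
  have h0 : 0 < β := by linarith
  have hi' : (0 : ℝ) ≤ i := by exact_mod_cast hi
  have key : ∀ t ∈ Ico (0 : ℝ) 1, 0 ≤ (i + t) / β ∧ (i + t) / β < (T β)^[n] 1 := by
    intro t ht
    refine ⟨by have := ht.1; positivity, ?_⟩
    rw [div_lt_iff₀ h0]
    have h1 : ((i : ℝ) + 1) ≤ digitSeq β 1 n := by exact_mod_cast h
    have h2 : (digitSeq β 1 n : ℝ) ≤ β * (T β)^[n] 1 := Int.floor_le _
    linarith [ht.2]
  have e : ∀ t : ℝ, lastPoint β n + i / β ^ (n + 1) + t / β ^ (n + 1) =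
      lastPoint β n + ((i + t) / β) / β ^ n := by
    intro t; rw [pow_succ]; field_simp; ring
  have D : ∀ t ∈ Ico (0 : ℝ) 1, ∀ j < n + 1,
      digitSeq β (lastPoint β n + i / β ^ (n + 1) + t / β ^ (n + 1)) j =
        if j < n then digitSeq β 1 j else i := by
    intro t ht j hj
    obtain ⟨-, h2, h3⟩ := lastPoint_add hβ n (key t ht).1 (key t ht).2
    rw [e]
    split_ifs with hjn
    · exact h3 j hjn
    · obtain rfl : j = n := by omega
      rw [digitSeq, h2, mul_div_cancel₀ _ h0.ne']
      simp [Int.floor_eq_iff, ht.1, ht.2]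
  intro t ht
  obtain ⟨h1, h2, h3⟩ := lastPoint_add hβ n (key t ht).1 (key t ht).2
  refine ⟨e t ▸ h1, ?_, fun j hj => ?_⟩
  · rw [e, Function.iterate_succ_apply', h2, T, mul_div_cancel₀ _ h0.ne', Int.floor_intCast_add,
      Int.floor_eq_zero_iff.2 ht]
    simp
  · have := D 0 (by simp) j hj
    simp only [zero_div, add_zero] at this
    rw [D t ht j hj, this]

/-- From some time `k` on, the first `n` digits of `z` follow the expansion of `1`. If the next
digit also follows it, `k` is kept; otherwise that digit is smaller and closes a new full interval
of order `n + 1`. -/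
lemma exists_isFull_lastPoint_le (hβ : 1 < β) (n : ℕ) {z : ℝ} (hz : z ∈ Ico (0 : ℝ) 1) :
    ∃ k ≤ n, ∃ c, IsFull β k c ∧ c + lastPoint β (n - k) / β ^ k ≤ z ∧ z < c + 1 / β ^ k := by
  have h0 : 0 < β := by linarith
  induction n with
  | zero => exact ⟨0, le_rfl, 0, isFull_zero 0 rfl, by simpa [lastPoint_zero] using hz⟩
  | succ n ih =>
    obtain ⟨k, hk, c, hc, h1, h2⟩ := ih
    rcases le_or_gt (c + lastPoint β (n + 1 - k) / β ^ k) z with h | h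
    · exact ⟨k, by omega, c, hc, h, h2⟩
    · obtain ⟨j, rfl⟩ := Nat.exists_eq_add_of_le hk
      rw [show k + j - k = j by omega] at h1
      rw [show k + j + 1 - k = j + 1 by omega, lastPoint_succ h0] at h
      set w := ((z - c) * β ^ k - lastPoint β j) * β ^ (j + 1) with hw
      have hbk : 0 < β ^ k := by positivity
      have hbj : 0 < β ^ (j + 1) := by positivity
      have hz' : z = c + (lastPoint β j + w / β ^ (j + 1)) / β ^ k := by
        rw [hw]; field_simp; ring
      have hw0 : 0 ≤ w := by
        rw [hw]; refine mul_nonneg ?_ hbj.le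
        rw [sub_nonneg, ← div_le_iff₀ hbk]; linarith
      have hw1 : w < digitSeq β 1 j := by
        rw [hz', add_lt_add_iff_left, div_lt_div_iff_of_pos_right hbk, add_lt_add_iff_left,
          div_lt_div_iff_of_pos_right hbj] at h
        exact h
      have hf : IsFull β (j + 1) (lastPoint β j + ⌊w⌋ / β ^ (j + 1)) :=
        isFull_lastPoint_add hβ j (Int.floor_nonneg.2 hw0) (Int.floor_lt.2 hw1)
      refine ⟨k + j + 1, le_rfl, _, hc.comp h0 hf, ?_, ?_⟩
      · simp only [Nat.sub_self, lastPoint_zero, zero_div, add_zero]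
        rw [hz']; gcongr; exact Int.floor_le _
      · have e : c + (lastPoint β j + ⌊w⌋ / β ^ (j + 1)) / β ^ k + 1 / β ^ (k + j + 1) =
            c + (lastPoint β j + (⌊w⌋ + 1) / β ^ (j + 1)) / β ^ k := by
          rw [show k + j + 1 = k + (j + 1) by ring, pow_add]; field_simp; ring
        rw [e, hz']; gcongr; exact Int.lt_floor_add_one _

lemma finite_isFull (hβ : 1 < β) (n : ℕ) : {c | IsFull β n c}.Finite := by
  have h0 : 0 < β := by linarith
  have hb : 0 < β ^ n := by positivity
  refine Set.Finite.of_finite_image (f := fun c => ⌊c * β ^ n⌋)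
    ((Set.finite_Icc (0 : ℤ) ⌊β ^ n⌋).subset ?_) ?_
  · rintro _ ⟨c, hc, rfl⟩
    have := (IsFull.self hc).1
    exact ⟨Int.floor_nonneg.2 (mul_nonneg this.1 hb.le), Int.floor_le_floor (by nlinarith [this.2])⟩
  · have key : ∀ c d, IsFull β n c → IsFull β n d → c < d → ⌊c * β ^ n⌋ ≠ ⌊d * β ^ n⌋ := by
      intro c d hc hd h
      have := mul_le_mul_of_nonneg_right (hc.add_inv_le h0 hd h) hb.le
      rw [add_mul, div_mul_cancel₀ _ hb.ne'] at this
      have := Int.floor_le_floor this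
      rw [Int.floor_add_one] at this
      omega
    intro c hc d hd h
    rcases lt_trichotomy c d with hlt | rfl | hlt
    · exact absurd h (key c d hc hd hlt)
    · rfl
    · exact absurd h.symm (key d c hd hc hlt)

/-- The pieces of the preceding decomposition have length at most `1 / β ^ n` and are indexed by a
time `k ≤ n` and a full interval, which may be taken of order `n` by padding with zeros. They cover
`[0,1)`, so their total length is at least `1`. -/
lemma pow_le_card_isFull (hβ : 1 < β) (n : ℕ) :
    β ^ n ≤ (n + 1) * (finite_isFull hβ n).toFinset.card := by
  have h0 : 0 < β := by linarith
  have hb : 0 < β ^ n := by positivity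
  set E := (finite_isFull hβ n).toFinset
  have hcov : Ico (0 : ℝ) 1 ⊆ ⋃ p ∈ Finset.range (n + 1) ×ˢ E,
      Ico (p.2 + lastPoint β (n - p.1) / β ^ p.1)
        (p.2 + lastPoint β (n - p.1) / β ^ p.1 + 1 / β ^ n) := by
    intro z hz
    obtain ⟨k, hk, c, hc, h1, h2⟩ := exists_isFull_lastPoint_le hβ n hz
    refine mem_iUnion₂.2 ⟨(k, c), ?_, h1, h2.trans_le ?_⟩
    · simp only [Finset.mem_product, Finset.mem_range]
      exact ⟨by omega, (finite_isFull hβ n).mem_toFinset.2 (hc.mono hβ hk)⟩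
    · have : lastPoint β (n - k) / β ^ k = 1 / β ^ k - (T β)^[n - k] 1 / β ^ n := by
        have : β ^ n = β ^ k * β ^ (n - k) := by rw [← pow_add]; congr 1; omega
        rw [this, lastPoint]; field_simp
      simp only [this]
      have : (T β)^[n - k] 1 / β ^ n ≤ 1 / β ^ n := by gcongr; exact (iterate_T_one_mem _).2
      linarith
  have hv := (MeasureTheory.measure_mono (μ := MeasureTheory.volume) hcov).trans
    (MeasureTheory.measure_biUnion_finset_le _ _)
  simp only [Real.volume_Ico, add_sub_cancel_left, Finset.sum_const, sub_zero,
    Finset.card_product, Finset.card_range, nsmul_eq_mul] at hv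
  rw [ENNReal.ofReal_one, ← ENNReal.ofReal_natCast, ← ENNReal.ofReal_mul (by positivity),
    ENNReal.one_le_ofReal] at hv
  push_cast at hv
  rw [mul_one_div, le_div_iff₀ hb] at hv
  linarith

/-! ### Letters -/

/-- The block letters: left endpoints of the full intervals of order `m` contained in
`[0, 1 - 1 / β ^ m]`. -/
def IsLetter (β : ℝ) (m : ℕ) (c : ℝ) : Prop := IsFull β m c ∧ c + 2 / β ^ m ≤ 1

lemma IsLetter.exists_digitSeq_ne_zero (hβ : 1 < β) {m : ℕ} {c : ℝ} (h : IsLetter β m c)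
    (hc : c ≠ 0) : ∃ s < m, digitSeq β c s ≠ 0 := by
  by_contra! H
  have h1 := iterate_T_of_digitSeq_eq_zero H
  rw [h.1.self.2] at h1
  have : β ^ m ≠ 0 := pow_ne_zero _ (by linarith)
  rcases mul_eq_zero.1 h1.symm with h | h
  · exact this h
  · exact hc h

lemma digitSeq_zero_right (i : ℕ) : digitSeq β 0 i = 0 := by
  have : ∀ i, (T β)^[i] 0 = 0 := by
    intro i
    induction i with
    | zero => rfl
    | succ i ih => rw [Function.iterate_succ_apply', ih]; simp [T]
  simp [digitSeq, this]

lemma exists_letters (hβ : 1 < β) (m : ℕ) : ∃ A : Finset ℝ,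
    (∀ c ∈ A, IsLetter β m c ∧ c ≠ 0) ∧ β ^ m ≤ (m + 1) * (A.card + 2) := by
  classical
  have h0 : 0 < β := by linarith
  set E := (finite_isFull hβ m).toFinset with hE
  have hne : E.Nonempty := ⟨0, (finite_isFull hβ m).mem_toFinset.2 (isFull_zero_right hβ m)⟩
  -- Zero is reserved for the marker; without the rightmost interval every letter leaves a gap of `1
  -- / β ^ m` before `1`.
  refine ⟨(E.erase 0).erase (E.max' hne), fun c hc => ?_, ?_⟩
  · rw [Finset.mem_erase, Finset.mem_erase] at hc
    have hmem : ∀ {d}, d ∈ E → IsFull β m d := fun h => (finite_isFull hβ m).mem_toFinset.1 h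
    have hlt : c < E.max' hne := lt_of_le_of_ne (E.le_max' c hc.2.2) hc.1
    have h1 := (hmem hc.2.2).add_inv_le h0 (hmem (E.max'_mem hne)) hlt
    have h2 := (hmem (E.max'_mem hne)).add_inv_le_one h0
    refine ⟨⟨hmem hc.2.2, ?_⟩, hc.2.1⟩
    have : 2 / β ^ m = 1 / β ^ m + 1 / β ^ m := by ring
    linarith
  · refine (pow_le_card_isFull hβ m).trans ?_
    have h1 := Finset.pred_card_le_card_erase (s := E) (a := 0)
    have h2 := Finset.pred_card_le_card_erase (s := E.erase 0) (a := E.max' hne)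
    have h3 : E.card ≤ ((E.erase 0).erase (E.max' hne)).card + 2 := by omega
    gcongr
    exact_mod_cast h3

/-- For every exponent `r < 1` there are blocks of arbitrarily large length `m` for which the number
of letters exceeds `β ^ (m r)`. -/
lemma eventually_exists_letters (hβ : 1 < β) {r : ℝ} (hr : r < 1) :
    ∀ᶠ m : ℕ in atTop, ∃ A : Finset ℝ,
      (∀ c ∈ A, IsLetter β m c ∧ c ≠ 0) ∧ β ^ (m * r) ≤ A.card := by
  have h0 : 0 < β := by linarith
  have hg : 1 < β ^ (1 - r) := Real.one_lt_rpow hβ (by linarith)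
  have hg0 : 0 < β ^ (1 - r) := by linarith
  have l1 : Tendsto (fun m : ℕ => (m : ℝ) ^ 1 / (β ^ (1 - r)) ^ m) atTop (nhds 0) :=
    tendsto_pow_const_div_const_pow_of_one_lt 1 hg
  have l2 : Tendsto (fun m : ℕ => (m : ℝ) ^ 0 / (β ^ (1 - r)) ^ m) atTop (nhds 0) :=
    tendsto_pow_const_div_const_pow_of_one_lt 0 hg
  have l3 : Tendsto (fun m : ℕ => (m : ℝ) ^ 1 / β ^ m) atTop (nhds 0) :=
    tendsto_pow_const_div_const_pow_of_one_lt 1 hβ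
  have l4 : Tendsto (fun m : ℕ => (m : ℝ) ^ 0 / β ^ m) atTop (nhds 0) :=
    tendsto_pow_const_div_const_pow_of_one_lt 0 hβ
  -- Times `β ^ m`, this expression is `(m + 1) (β ^ (m r) + 2)`; once it is below `1`, the count in
  -- `exists_letters` forces more than `β ^ (m r)` letters.
  have l : Tendsto (fun m : ℕ => ((m : ℝ) + 1) / (β ^ (1 - r)) ^ m + 2 * ((m + 1) / β ^ m))
      atTop (nhds 0) := by
    have := (l1.add l2).add ((l3.add l4).const_mul 2)
    simp only [pow_one, pow_zero, add_zero, mul_zero] at this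
    refine this.congr fun m => ?_
    rw [add_div, add_div]
  filter_upwards [l.eventually_lt_const one_pos] with m hm
  obtain ⟨A, hA, hcard⟩ := exists_letters hβ m
  refine ⟨A, hA, ?_⟩
  have e : (β ^ (1 - r)) ^ m * β ^ (m * r) = β ^ m := by
    rw [← Real.rpow_natCast, ← Real.rpow_mul h0.le, ← Real.rpow_add h0, ← Real.rpow_natCast]
    congr 1; ring
  by_contra! hlt
  have hb : 0 < β ^ m := by positivity
  have hq : (0 : ℝ) < (β ^ (1 - r)) ^ m := by positivity
  have h1 : ((m : ℝ) + 1) / (β ^ (1 - r)) ^ m * β ^ m = (m + 1) * β ^ (m * r) := by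
    rw [← e]; field_simp
  have h2 : 2 * (((m : ℝ) + 1) / β ^ m) * β ^ m = 2 * (m + 1) := by field_simp
  have h3 := mul_lt_mul_of_pos_right hm hb
  rw [add_mul, h1, h2, one_mul] at h3
  have : ((m : ℝ) + 1) * (A.card + 2) ≤ (m + 1) * (β ^ (m * r) + 2) := by gcongr
  nlinarith

/-! ### Coding points by sequences of letters -/

/-- The point of `[0,1)` whose `β`-expansion is the concatenation of the blocks `c i`. -/
noncomputable def code (β : ℝ) (m : ℕ) (c : ℕ → ℝ) : ℝ := ∑' i, c i / (β ^ m) ^ i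

section code
variable {m : ℕ} {c : ℕ → ℝ}

lemma IsLetter.mem {d : ℝ} (h : IsLetter β m d) : 0 ≤ d ∧ d ≤ 1 - 2 / β ^ m :=
  ⟨h.1.self.1.1, by linarith [h.2]⟩

lemma summable_code (hβ : 1 < β) (hm : m ≠ 0) (hc : ∀ i, IsLetter β m (c i)) :
    Summable fun i => c i / (β ^ m) ^ i := by
  have hb : 1 < β ^ m := one_lt_pow₀ hβ hm
  have hb0 : 0 < β ^ m := by linarith
  refine Summable.of_nonneg_of_le (fun i => ?_) (fun i => ?_)
    (summable_geometric_of_lt_one (r := (β ^ m)⁻¹) (by positivity) (inv_lt_one_of_one_lt₀ hb))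
  · have := (hc i).1.self.1.1; positivity
  · have := (hc i).1.self.1.2.le
    rw [inv_pow, div_eq_mul_inv]
    exact mul_le_of_le_one_left (by positivity) this

lemma code_eq (hβ : 1 < β) (hm : m ≠ 0) (hc : ∀ i, IsLetter β m (c i)) :
    code β m c = c 0 + code β m (fun i => c (i + 1)) / β ^ m := by
  rw [code, (summable_code hβ hm hc).tsum_eq_zero_add, code, ← tsum_div_const]
  simp only [pow_zero, div_one, pow_succ, div_div]

lemma code_nonneg (h0 : 0 < β) (hc : ∀ i, IsLetter β m (c i)) : 0 ≤ code β m c :=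
  tsum_nonneg fun i => by have := (hc i).1.self.1.1; positivity

/-- With `b = β ^ m`, the geometric series gives `(1 - 2/b) / (1 - 1/b)`, and `1 - 2/b ≤ (1 -
1/b)^2`. -/
lemma code_le (hβ : 1 < β) (hm : m ≠ 0) (hc : ∀ i, IsLetter β m (c i)) :
    code β m c ≤ 1 - 1 / β ^ m := by
  have hb : 1 < β ^ m := one_lt_pow₀ hβ hm
  have hb0 : 0 < β ^ m := by linarith
  have hb1 : (β ^ m)⁻¹ < 1 := inv_lt_one_of_one_lt₀ hb
  have hg := summable_geometric_of_lt_one (r := (β ^ m)⁻¹) (by positivity) hb1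
  have h1 : code β m c ≤ ∑' i : ℕ, (1 - 2 / β ^ m) * (β ^ m)⁻¹ ^ i := by
    refine (summable_code hβ hm hc).tsum_le_tsum (fun i => ?_) (hg.mul_left _)
    rw [inv_pow, div_eq_mul_inv]
    gcongr
    exact (hc i).mem.2
  rw [tsum_mul_left, tsum_geometric_of_lt_one (by positivity) hb1, ← div_eq_mul_inv] at h1
  refine h1.trans ?_
  rw [div_le_iff₀ (by linarith)]
  have : (0 : ℝ) ≤ (β ^ m)⁻¹ * (β ^ m)⁻¹ := by positivity
  rw [div_eq_mul_inv, one_div]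
  nlinarith

lemma code_mem (hβ : 1 < β) (hm : m ≠ 0) (hc : ∀ i, IsLetter β m (c i)) :
    code β m c ∈ Ico (0 : ℝ) 1 := by
  have : 0 < 1 / β ^ m := by positivity
  exact ⟨code_nonneg (by linarith) hc, by linarith [code_le hβ hm hc]⟩

lemma iterate_T_code (hβ : 1 < β) (hm : m ≠ 0) (hc : ∀ i, IsLetter β m (c i)) (k : ℕ) :
    (T β)^[m * k] (code β m c) = code β m (fun i => c (i + k)) := by
  induction k with
  | zero => simp
  | succ k ih =>
    have hk : ∀ i, IsLetter β m (c (i + k)) := fun i => hc _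
    rw [mul_add_one, add_comm, Function.iterate_add_apply, ih, code_eq hβ hm hk,
      ((hk 0).1 _ (code_mem hβ hm fun i => hk (i + 1))).2.1]
    simp only [add_assoc, add_comm 1 k]

lemma digitSeq_code (hβ : 1 < β) (hm : m ≠ 0) (hc : ∀ i, IsLetter β m (c i)) (k : ℕ) {s : ℕ}
    (hs : s < m) : digitSeq β (code β m c) (m * k + s) = digitSeq β (c k) s := by
  have hk : ∀ i, IsLetter β m (c (i + k)) := fun i => hc _
  rw [← digitSeq_iterate, iterate_T_code hβ hm hc, code_eq hβ hm hk,
    ((hk 0).1 _ (code_mem hβ hm fun i => hk (i + 1))).2.2 s hs, zero_add]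

lemma code_sub_code_of_eq (hβ : 1 < β) (hm : m ≠ 0) {d : ℕ → ℝ} (hc : ∀ i, IsLetter β m (c i))
    (hd : ∀ i, IsLetter β m (d i)) {k : ℕ} (h : ∀ i < k, c i = d i) :
    code β m c - code β m d =
      (code β m (fun i => c (i + k)) - code β m (fun i => d (i + k))) / (β ^ m) ^ k := by
  have hb : β ^ m ≠ 0 := pow_ne_zero _ (by linarith)
  induction k with
  | zero => simp
  | succ k ih =>
    rw [ih fun i hi => h i (by omega), code_eq hβ hm (c := fun i => c (i + k)) fun i => hc _,
      code_eq hβ hm (c := fun i => d (i + k)) fun i => hd _]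
    simp only [zero_add, h k k.lt_succ_self, add_assoc, add_comm 1 k]
    rw [pow_succ]; field_simp; ring

/-- The intervals of two distinct letters do not overlap, and by `code_le` the tail after the
smaller letter stays `1 / (β ^ m) ^ 2` away from the right end of its interval. -/
lemma le_code_sub_code (hβ : 1 < β) (hm : m ≠ 0) {d : ℕ → ℝ} (hc : ∀ i, IsLetter β m (c i))
    (hd : ∀ i, IsLetter β m (d i)) {k : ℕ} (h : ∀ i < k, c i = d i) (hk : c k < d k) :
    1 / (β ^ m) ^ (k + 2) ≤ code β m d - code β m c := by
  have h0 : 0 < β := by linarith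
  have hb : 0 < β ^ m := by positivity
  rw [code_sub_code_of_eq hβ hm hd hc fun i hi => (h i hi).symm,
    code_eq hβ hm (c := fun i => c (i + k)) fun i => hc _,
    code_eq hβ hm (c := fun i => d (i + k)) fun i => hd _]
  simp only [zero_add]
  have h1 := (hc k).1.add_inv_le h0 (hd k).1 hk
  have h2 := code_le hβ hm (c := fun i => c (i + 1 + k)) fun i => hc _
  have h3 := code_nonneg h0 (m := m) (c := fun i => d (i + 1 + k)) fun i => hd _
  have h4 : code β m (fun i => c (i + 1 + k)) / β ^ m ≤ (1 - 1 / β ^ m) / β ^ m := by gcongr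
  have h5 : 0 ≤ code β m (fun i => d (i + 1 + k)) / β ^ m := by positivity
  have h6 : 1 / β ^ m - (1 - 1 / β ^ m) / β ^ m = 1 / (β ^ m) ^ 2 := by field_simp; ring
  have h7 : 1 / (β ^ m) ^ (k + 2) = 1 / (β ^ m) ^ 2 / (β ^ m) ^ k := by
    rw [pow_add]; field_simp
  rw [h7]
  gcongr
  linarith

lemma le_abs_code_sub_code (hβ : 1 < β) (hm : m ≠ 0) {d : ℕ → ℝ} (hc : ∀ i, IsLetter β m (c i))
    (hd : ∀ i, IsLetter β m (d i)) {k : ℕ} (h : ∀ i < k, c i = d i) (hk : c k ≠ d k) :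
    1 / (β ^ m) ^ (k + 2) ≤ |code β m c - code β m d| := by
  rcases lt_or_gt_of_ne hk with hk | hk
  · rw [abs_sub_comm]
    exact (le_code_sub_code hβ hm hc hd h hk).trans (le_abs_self _)
  · exact (le_code_sub_code hβ hm hd hc (fun i hi => (h i hi).symm) hk).trans (le_abs_self _)

end code

/-! ### Inserting prefixes into a sequence -/

/-- The positions overwritten by the `l`-th insertion, `l ≥ 5`, which occupies the `l + 1` places
from `P l` on. -/
def Inserted (P : ℕ → ℕ) (j : ℕ) : Prop := ∃ l, 5 ≤ l ∧ P l ≤ j ∧ j ≤ P l + l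

/-- Consecutive insertions are disjoint and do not touch. -/
def Separated (P : ℕ → ℕ) : Prop := ∀ l, 5 ≤ l → P l + l + 2 ≤ P (l + 1)

/-- The number of places below `j` that are not overwritten. -/
noncomputable def freeCount (P : ℕ → ℕ) (j : ℕ) : ℕ :=
  open Classical in Nat.count (fun i => ¬ Inserted P i) j

/-- The sequence `v` preceded by the marker `0000`. -/
def withMarker (v : ℕ → ℝ) (i : ℕ) : ℝ := if i < 4 then 0 else v (i - 4)

open Classical in
/-- The sequence `u` spread over the free places; at `P l` the first `l` terms of `Y` are inserted,
followed by a `0`. -/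
noncomputable def insertPrefixes (P : ℕ → ℕ) (Y u : ℕ → ℝ) (j : ℕ) : ℝ :=
  if h : Inserted P j then
    if j - P h.choose < h.choose then Y (j - P h.choose) else 0
  else u (freeCount P j)

lemma Separated.lt {P : ℕ → ℕ} (hP : Separated P) {l k : ℕ} (hl : 5 ≤ l) (hlk : l < k) :
    P l + l + 2 ≤ P k := by
  induction k, hlk using Nat.le_induction with
  | base => exact hP l hl
  | succ k hk ih => have := hP k (by omega); omega

lemma Separated.monotone {P : ℕ → ℕ} (hP : Separated P) {l k : ℕ} (hl : 5 ≤ l) (hlk : l ≤ k) :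
    P l ≤ P k := by
  rcases hlk.eq_or_lt with rfl | h
  · rfl
  · have := hP.lt hl h; omega

lemma Separated.unique {P : ℕ → ℕ} (hP : Separated P) {l k j : ℕ} (hl : 5 ≤ l) (hk : 5 ≤ k)
    (h1 : P l ≤ j) (h2 : j ≤ P l + l) (h3 : P k ≤ j) (h4 : j ≤ P k + k) : l = k := by
  rcases lt_trichotomy l k with h | h | h
  · have := hP.lt hl h; omega
  · exact h
  · have := hP.lt hk h; omega

section insertPrefixes
variable {P : ℕ → ℕ} {Y u v : ℕ → ℝ}

lemma insertPrefixes_of_le (hP : Separated P) {l i : ℕ} (hl : 5 ≤ l) (hi : i ≤ l) :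
    insertPrefixes P Y u (P l + i) = if i < l then Y i else 0 := by
  have h : Inserted P (P l + i) := ⟨l, hl, by omega, by omega⟩
  have e : h.choose = l :=
    hP.unique h.choose_spec.1 hl h.choose_spec.2.1 h.choose_spec.2.2 (by omega) (by omega)
  rw [insertPrefixes, dif_pos h, e, Nat.add_sub_cancel_left]

lemma insertPrefixes_of_free {j : ℕ} (h : ¬ Inserted P j) :
    insertPrefixes P Y u j = u (freeCount P j) := dif_neg h

lemma insertPrefixes_eq_zero (hP : Separated P) (hu : ∀ i, u i ≠ 0) (hY : ∀ i, 4 ≤ i → Y i ≠ 0)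
    {j : ℕ} (h : insertPrefixes P Y u j = 0) :
    ∃ l i, 5 ≤ l ∧ j = P l + i ∧ (i < 4 ∨ i = l) := by
  by_cases hj : Inserted P j
  · obtain ⟨l, hl, h1, h2⟩ := hj
    obtain ⟨i, rfl⟩ := Nat.exists_eq_add_of_le h1
    refine ⟨l, i, hl, rfl, ?_⟩
    rw [insertPrefixes_of_le hP hl (by omega)] at h
    by_contra! H
    rw [if_pos (by omega)] at h
    exact hY i H.1 h
  · rw [insertPrefixes_of_free hj] at h
    exact absurd h (hu _)

/-- Zeros come only from the four marker places and from closing zeros. A closing zero is isolated: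
it follows a nonzero term since `l ≥ 5`, and the place after it is free by separation. -/
lemma insertPrefixes_three_zeros (hP : Separated P) (hu : ∀ i, u i ≠ 0)
    (hY : ∀ i, 4 ≤ i → Y i ≠ 0) {j : ℕ} (h0 : insertPrefixes P Y u j = 0)
    (h1 : insertPrefixes P Y u (j + 1) = 0) (h2 : insertPrefixes P Y u (j + 2) = 0) :
    ∃ l, 5 ≤ l ∧ (j = P l ∨ j = P l + 1) := by
  obtain ⟨l, i, hl, rfl, hi⟩ := insertPrefixes_eq_zero hP hu hY h0
  have key : ∀ i', insertPrefixes P Y u (P l + i') = 0 → i' ≤ l + 1 → i' < 4 ∨ i' = l := by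
    intro i' h hi'
    obtain ⟨l', k, hl', he, hk⟩ := insertPrefixes_eq_zero hP hu hY h
    rcases lt_trichotomy l l' with hlt | rfl | hlt
    · have := hP.lt hl hlt; omega
    · omega
    · have := hP.lt hl' hlt; omega
  have k1 := key (i + 1) h1 (by omega)
  have k2 := fun h => key (i + 2) h2 h
  refine ⟨l, hl, ?_⟩
  by_cases hi2 : i + 2 ≤ l + 1
  · have := k2 hi2; omega
  · omega

lemma withMarker_ne_zero (hv : ∀ i, v i ≠ 0) {i : ℕ} (hi : 4 ≤ i) : withMarker v i ≠ 0 := by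
  rw [withMarker, if_neg (by omega)]; exact hv _

lemma withMarker_of_lt {i : ℕ} (hi : i < 4) : withMarker v i = 0 := if_pos hi

/-- Each term `u k` with `k < freeCount P i` can thus be read off at a place before `i`. -/
lemma exists_freeCount_eq {i k : ℕ} (h : k < freeCount P i) :
    ∃ j < i, ¬ Inserted P j ∧ freeCount P j = k := by
  classical
  unfold freeCount at *
  induction i with
  | zero => simp at h
  | succ i ih =>
    rw [Nat.count_succ] at h
    by_cases hk : k < Nat.count (fun i => ¬ Inserted P i) i
    · obtain ⟨j, hj, h1⟩ := ih hk
      exact ⟨j, by omega, h1⟩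
    · by_cases hi : Inserted P i
      · rw [if_neg (not_not.2 hi)] at h; omega
      · rw [if_pos hi] at h
        exact ⟨i, by omega, hi, by omega⟩

/-- An overwritten place below `i` is `P l + s` with `s ≤ l`, and `2 ^ l ≤ P l < i` leaves at most
`log₂ i + 1` values for each of `l` and `s`. -/
lemma le_freeCount_add (hpow : ∀ l, 5 ≤ l → 2 ^ l ≤ P l) (i : ℕ) :
    i ≤ freeCount P i + (Nat.log 2 i + 1) ^ 2 := by
  classical
  have h1 := Finset.card_filter_add_card_filter_not (s := Finset.range i)
    (fun j => ¬ Inserted P j)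
  rw [freeCount, Nat.count_eq_card_filter_range]
  have h2 : ((Finset.range i).filter fun j => ¬ ¬ Inserted P j).card ≤
      (Nat.log 2 i + 1) ^ 2 := by
    have hsub : ((Finset.range i).filter fun j => ¬ ¬ Inserted P j) ⊆
        (Finset.range (Nat.log 2 i + 1) ×ˢ Finset.range (Nat.log 2 i + 1)).image
          fun p => P p.1 + p.2 := by
      intro j hj
      simp only [Finset.mem_filter, Finset.mem_range, not_not] at hj
      obtain ⟨hji, l, hl, h3, h4⟩ := hj
      have hlog : l ≤ Nat.log 2 i :=
        Nat.le_log_of_pow_le (by norm_num) ((hpow l hl).trans (by omega))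
      simp only [Finset.mem_image, Finset.mem_product, Finset.mem_range, Prod.exists]
      exact ⟨l, j - P l, ⟨by omega, by omega⟩, by omega⟩
    refine (Finset.card_le_card hsub).trans (Finset.card_image_le.trans ?_)
    rw [Finset.card_product, Finset.card_range, sq]
  rw [Finset.card_range] at h1
  omega

lemma exists_mul_le_freeCount (hpow : ∀ l, 5 ≤ l → 2 ^ l ≤ P l) {ε : ℝ} (hε : 0 < ε) :
    ∃ C : ℝ, ∀ i : ℕ, (1 - ε) * i - C ≤ freeCount P i := by
  have l : Tendsto (fun n : ℕ => ((n : ℝ) + 1) ^ 2 / 2 ^ n) atTop (nhds 0) := by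
    have := ((tendsto_add_atTop_iff_nat 1).2
      (tendsto_pow_const_div_const_pow_of_one_lt 2 (one_lt_two (α := ℝ)))).const_mul 2
    rw [mul_zero] at this
    refine this.congr fun n => ?_
    push_cast; rw [pow_succ (2 : ℝ) n]; field_simp
  obtain ⟨N, hN⟩ := eventually_atTop.1 (l.eventually_lt_const hε)
  refine ⟨((N : ℝ) + 1) ^ 2 + 1, fun i => ?_⟩
  have h1 : (i : ℝ) ≤ freeCount P i + ((Nat.log 2 i : ℝ) + 1) ^ 2 := by
    exact_mod_cast le_freeCount_add hpow i
  have h2 : ((Nat.log 2 i : ℝ) + 1) ^ 2 ≤ ε * i + (((N : ℝ) + 1) ^ 2 + 1) := by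
    rcases le_or_gt N (Nat.log 2 i) with h | h
    · have := (hN _ h).le
      rw [div_le_iff₀ (by positivity)] at this
      rcases eq_or_ne i 0 with rfl | hi
      · simp; positivity
      · have h3 : ((2 : ℝ) ^ Nat.log 2 i) ≤ i := by exact_mod_cast Nat.pow_log_le_self 2 hi
        have : ε * (2 : ℝ) ^ Nat.log 2 i ≤ ε * i := by gcongr
        nlinarith [sq_nonneg ((N : ℝ) + 1)]
    · have : (Nat.log 2 i : ℝ) ≤ N := by exact_mod_cast h.le
      have h4 : ((Nat.log 2 i : ℝ) + 1) ^ 2 ≤ ((N : ℝ) + 1) ^ 2 := by gcongr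
      have : 0 ≤ ε * i := by positivity
      linarith
  linarith

end insertPrefixes

/-! ### Locating prefixes of `y` in `x`, and the waiting time -/

section match_digits
variable {P : ℕ → ℕ} {m : ℕ} {u v : ℕ → ℝ}

lemma isLetter_zero (hβ : 1 < β) (h2 : 2 ≤ β ^ m) : IsLetter β m 0 :=
  ⟨isFull_zero_right hβ m, by rw [zero_add, div_le_one (by linarith)]; exact h2⟩

lemma isLetter_withMarker (hβ : 1 < β) (h2 : 2 ≤ β ^ m) (hv : ∀ i, IsLetter β m (v i)) (i : ℕ) :
    IsLetter β m (withMarker v i) := by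
  rw [withMarker]; split_ifs
  · exact isLetter_zero hβ h2
  · exact hv _

lemma isLetter_insertPrefixes {Y : ℕ → ℝ} (hβ : 1 < β) (h2 : 2 ≤ β ^ m)
    (hY : ∀ i, IsLetter β m (Y i)) (hu : ∀ i, IsLetter β m (u i)) (i : ℕ) :
    IsLetter β m (insertPrefixes P Y u i) := by
  rw [insertPrefixes]; split_ifs
  · exact hY _
  · exact isLetter_zero hβ h2
  · exact hu _

lemma eq_zero_of_digitSeq_code (hβ : 1 < β) (hm : m ≠ 0) {c : ℕ → ℝ}
    (hc : ∀ i, IsLetter β m (c i)) {k : ℕ}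
    (h : ∀ s < m, digitSeq β (code β m c) (m * k + s) = 0) : c k = 0 := by
  by_contra H
  obtain ⟨s, hs, hne⟩ := (hc k).exists_digitSeq_ne_zero hβ H
  exact hne (digitSeq_code hβ hm hc k hs ▸ h s hs)

lemma digitSeq_code_eq_div_mod (hβ : 1 < β) (hm : m ≠ 0) {c : ℕ → ℝ}
    (hc : ∀ i, IsLetter β m (c i)) (p : ℕ) :
    digitSeq β (code β m c) p = digitSeq β (c (p / m)) (p % m) := by
  conv_lhs => rw [← Nat.div_add_mod p m]
  exact digitSeq_code hβ hm hc _ (Nat.mod_lt _ (by omega))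

lemma digitSeq_agree_of_inserted {Y : ℕ → ℝ} (hβ : 1 < β) (hm : m ≠ 0) (h2 : 2 ≤ β ^ m)
    (hP : Separated P) (hY : ∀ i, IsLetter β m (Y i)) (hu : ∀ i, IsLetter β m (u i))
    {l : ℕ} (hl : 5 ≤ l) {i : ℕ} (hi : i < m * l) :
    digitSeq β (code β m (insertPrefixes P Y u)) (m * P l + i) = digitSeq β (code β m Y) i := by
  have hi' : i / m < l := Nat.div_lt_of_lt_mul hi
  rw [digitSeq_code_eq_div_mod hβ hm (isLetter_insertPrefixes hβ h2 hY hu),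
    digitSeq_code_eq_div_mod hβ hm hY, Nat.mul_add_div (by omega), Nat.mul_add_mod,
    insertPrefixes_of_le hP hl hi'.le, if_pos hi']

/-- The match is not assumed to start at a block boundary. The marker locates it up to less than a
block, the first nonzero digit of `y` fixes it exactly, and the closing `0` bounds its length. -/
lemma exists_inserted_of_digitSeq_agree (hβ : 1 < β) (hm : m ≠ 0) (h2 : 2 ≤ β ^ m)
    (hP : Separated P) (hu : ∀ i, IsLetter β m (u i) ∧ u i ≠ 0)
    (hv : ∀ i, IsLetter β m (v i) ∧ v i ≠ 0) {k n : ℕ} (hn : 5 * m ≤ n)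
    (h : ∀ i < n, digitSeq β (code β m (insertPrefixes P (withMarker v) u)) (k + i) =
      digitSeq β (code β m (withMarker v)) i) :
    ∃ l, 5 ≤ l ∧ k = m * P l ∧ n < m * (l + 1) := by
  have hm0 : 0 < m := by omega
  set Y := withMarker v with hYdef
  set X := insertPrefixes P Y u with hXdef
  have hY : ∀ i, IsLetter β m (Y i) := isLetter_withMarker hβ h2 fun i => (hv i).1
  have hX : ∀ i, IsLetter β m (X i) := isLetter_insertPrefixes hβ h2 hY fun i => (hu i).1
  have hY4 : ∀ i, 4 ≤ i → Y i ≠ 0 := fun i hi => withMarker_ne_zero (fun i => (hv i).2) hi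
  have hy0 : ∀ i < 4 * m, digitSeq β (code β m Y) i = 0 := by
    intro i hi
    rw [digitSeq_code_eq_div_mod hβ hm hY, hYdef,
      withMarker_of_lt (Nat.div_lt_of_lt_mul (by linarith)), digitSeq_zero_right]
  -- `j` is `k / m` rounded up: the `4 m` zero digits from `k` on contain the three whole blocks
  -- `j`, `j + 1`, `j + 2`.
  obtain ⟨j, hj1, hj2⟩ : ∃ j, k ≤ m * j ∧ m * j < k + m := by
    refine ⟨(k + m - 1) / m, ?_, ?_⟩
    · have := Nat.div_add_mod (k + m - 1) m
      have := Nat.mod_lt (k + m - 1) hm0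
      omega
    · have := Nat.mul_div_le (k + m - 1) m
      omega
  have hz : ∀ b < 3, X (j + b) = 0 := by
    intro b hb
    refine eq_zero_of_digitSeq_code hβ hm hX fun s hs => ?_
    have hbm : m * b ≤ m * 2 := Nat.mul_le_mul_left m (by omega)
    obtain ⟨i, hi⟩ := Nat.exists_eq_add_of_le (show k ≤ m * (j + b) + s by rw [mul_add]; omega)
    rw [mul_add] at hi
    rw [mul_add, hi, h i (by omega), hy0 i (by omega)]
  obtain ⟨l, hl, hjl⟩ := insertPrefixes_three_zeros hP (fun i => (hu i).2) hY4
    (hz 0 (by norm_num)) (hz 1 (by norm_num)) (hz 2 (by norm_num))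
  have hXl : ∀ i < l, X (P l + i) = Y i := fun i hi => by
    rw [hXdef, insertPrefixes_of_le hP hl hi.le, if_pos hi]
  -- `m * 4 + s` is the position of the first nonzero digit of `y`; it is below `5 m ≤ n`, hence
  -- inside the match.
  obtain ⟨s, ⟨hs, hsne⟩, hmin⟩ : ∃ s, (s < m ∧ digitSeq β (Y 4) s ≠ 0) ∧
      ∀ t < s, digitSeq β (Y 4) t = 0 := by
    classical
    have hex := (hY 4).exists_digitSeq_ne_zero hβ (hY4 4 le_rfl)
    refine ⟨Nat.find hex, Nat.find_spec hex, fun t ht => ?_⟩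
    have := Nat.find_min hex ht
    have hlt := (Nat.find_spec hex).1
    by_contra H
    exact this ⟨by omega, H⟩
  have hgN : digitSeq β (code β m Y) (m * 4 + s) ≠ 0 := by rwa [digitSeq_code hβ hm hY 4 hs]
  have hg0 : ∀ i < m * 4 + s, digitSeq β (code β m Y) i = 0 := by
    intro i hi
    rcases lt_or_ge i (4 * m) with h4 | h4
    · exact hy0 i h4
    · obtain ⟨t, rfl⟩ := Nat.exists_eq_add_of_le' (show m * 4 ≤ i by omega)
      rw [add_comm, digitSeq_code hβ hm hY 4 (by omega)]
      exact hmin t (by omega)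
  have hfN : digitSeq β (code β m X) (m * P l + (m * 4 + s)) ≠ 0 := by
    rwa [← add_assoc, ← mul_add, digitSeq_code hβ hm hX _ hs, hXl 4 (by omega)]
  have hagree : ∀ i < m * l, digitSeq β (code β m X) (m * P l + i) = digitSeq β (code β m Y) i :=
    fun i hi => digitSeq_agree_of_inserted hβ hm h2 hP hY (fun i => (hu i).1) hl hi
  have h5l : m * 5 ≤ m * l := Nat.mul_le_mul_left m hl
  have hjm : m * j = m * P l ∨ m * j = m * P l + m := by
    rcases hjl with rfl | rfl
    · exact Or.inl rfl
    · exact Or.inr (by ring)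
  -- Both the digits of `y` and those of `x` from `m * P l` on are first nonzero at `m * 4 + s`; any
  -- shift of the match would pair a nonzero digit with a zero one.
  have hk : k = m * P l := by
    rcases lt_trichotomy k (m * P l) with hlt | heq | hlt
    · exfalso
      obtain ⟨i, hi⟩ := Nat.exists_eq_add_of_le (show m * P l ≤ k + (m * 4 + s) by omega)
      have h1 := h (m * 4 + s) (by omega)
      rw [hi, hagree i (by omega), hg0 i (by omega)] at h1
      exact hgN h1.symm
    · exact heq
    · exfalso
      obtain ⟨i, hi⟩ := Nat.exists_eq_add_of_le (show k ≤ m * P l + (m * 4 + s) by omega)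
      rw [hi, h i (by omega), hg0 i (by omega)] at hfN
      exact hfN rfl
  -- A longer match would identify block `l` of `y`, which is nonzero, with the closing `0`.
  refine ⟨l, hl, hk, ?_⟩
  by_contra! hle
  rw [mul_add_one] at hle
  refine hY4 l (by omega) (eq_zero_of_digitSeq_code hβ hm hY fun s hs => ?_)
  rw [← h _ (by omega), hk, ← add_assoc, ← mul_add, digitSeq_code hβ hm hX _ hs, hXdef,
    insertPrefixes_of_le hP hl le_rfl, if_neg (lt_irrefl l), digitSeq_zero_right]

end match_digits

lemma mem_basicInterval_iff {x y : ℝ} (hx : x ∈ Ico (0 : ℝ) 1) (n k : ℕ) :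
    (T β)^[k] x ∈ basicInterval β n y ↔
      ∀ i < n, digitSeq β x (k + i) = digitSeq β y i := by
  simp only [basicInterval, mem_ofPred_eq, iterate_T_mem hx k, true_and, ← digitSeq_iterate]
  constructor
  · intro h i hi
    exact h (i + 1) (by omega) (by omega)
  · intro h i h1 h2
    have := h (i - 1) (by omega)
    exact this

/-- A hit occurs only at some `m * P l` with `n < m * (l + 1)`, that is `l ≥ n / m`; insertion `n /
m + 1` carries more than `n` digits of `y` and so is a hit. -/
lemma waitingTime_bounds {P : ℕ → ℕ} {m : ℕ} {u v : ℕ → ℝ} (hβ : 1 < β) (hm : m ≠ 0)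
    (h2 : 2 ≤ β ^ m) (hP : Separated P) (hu : ∀ i, IsLetter β m (u i) ∧ u i ≠ 0)
    (hv : ∀ i, IsLetter β m (v i) ∧ v i ≠ 0) {n : ℕ} (hn : 5 * m ≤ n) :
    ((m * P (n / m) : ℕ) : ℕ∞) ≤ waitingTime β n
        (code β m (insertPrefixes P (withMarker v) u)) (code β m (withMarker v)) ∧
      waitingTime β n (code β m (insertPrefixes P (withMarker v) u)) (code β m (withMarker v)) ≤
        ((m * P (n / m + 1) : ℕ) : ℕ∞) := by
  have hm0 : 0 < m := by omega
  have hY : ∀ i, IsLetter β m (withMarker v i) := isLetter_withMarker hβ h2 fun i => (hv i).1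
  have hX := isLetter_insertPrefixes (P := P) hβ h2 hY fun i => (hu i).1
  have hx := code_mem hβ hm hX
  have h5 : 5 ≤ n / m := (Nat.le_div_iff_mul_le hm0).2 hn
  constructor
  · refine le_iInf₂ fun k hk => ?_
    obtain ⟨l, hl, rfl, hnl⟩ := exists_inserted_of_digitSeq_agree hβ hm h2 hP hu hv hn
      ((mem_basicInterval_iff hx n k).1 hk.2)
    have h1 : n / m ≤ l := Nat.lt_succ_iff.1 (Nat.div_lt_of_lt_mul hnl)
    exact_mod_cast Nat.mul_le_mul_left m (hP.monotone h5 h1)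
  · refine iInf₂_le _ ⟨?_, (mem_basicInterval_iff hx n _).2 fun i hi => ?_⟩
    · have := hP _ h5
      exact Nat.mul_pos hm0 (by omega)
    · have : n < m * (n / m + 1) := Nat.lt_mul_div_succ n hm0
      exact digitSeq_agree_of_inserted hβ hm h2 hP hY (fun i => (hu i).1) (by omega) (by omega)

/-! ### Hausdorff dimension of the insertion set -/

/-- The estimate makes `Ψ` factor through `Φ` by an `r`-Hölder map on `range Φ`, and such a map
multiplies dimension by at most `1 / r`. -/
lemma mul_dimH_range_le {ι X Y : Type*} [Nonempty ι] [MetricSpace X] [MetricSpace Y]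
    {Φ : ι → X} {Ψ : ι → Y} {C r : NNReal} (hr : 0 < r)
    (h : ∀ s t, dist (Ψ s) (Ψ t) ≤ C * dist (Φ s) (Φ t) ^ (r : ℝ)) :
    r * dimH (range Ψ) ≤ dimH (range Φ) := by
  have hr' : (r : ℝ) ≠ 0 := by exact_mod_cast hr.ne'
  have hinv : ∀ s, Φ (Function.invFun Φ (Φ s)) = Φ s := fun s => Function.invFun_eq ⟨s, rfl⟩
  have hΨ : ∀ s, Ψ (Function.invFun Φ (Φ s)) = Ψ s := fun s => by
    have := h (Function.invFun Φ (Φ s)) s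
    rw [hinv, dist_self, Real.zero_rpow hr', mul_zero] at this
    exact dist_le_zero.1 this
  have hold : HolderOnWith C r (Ψ ∘ Function.invFun Φ) (range Φ) := by
    rintro _ ⟨s, rfl⟩ _ ⟨t, rfl⟩
    simp only [Function.comp, hΨ]
    rw [edist_dist, edist_dist, ENNReal.ofReal_rpow_of_nonneg dist_nonneg r.coe_nonneg,
      ← ENNReal.ofReal_coe_nnreal, ← ENNReal.ofReal_mul C.coe_nonneg]
    exact ENNReal.ofReal_le_ofReal (h s t)
  have himg : (Ψ ∘ Function.invFun Φ) '' range Φ = range Ψ := by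
    rw [← range_comp]
    exact congrArg range (funext hΨ)
  have := hold.dimH_image_le hr
  rw [himg] at this
  rw [mul_comm]
  exact ENNReal.mul_le_of_le_div this

lemma two_le_dimH_range_ofDigits {q : ℕ} (hq : 1 < q) :
    2 ≤ dimH (range fun p : (ℕ → Fin q) × (ℕ → Fin q) =>
      (Real.ofDigits p.1, Real.ofDigits p.2)) := by
  have hsub : Icc (0 : ℝ) 1 ×ˢ Icc (0 : ℝ) 1 ⊆ range fun p : (ℕ → Fin q) × (ℕ → Fin q) =>
      (Real.ofDigits p.1, Real.ofDigits p.2) := by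
    rintro ⟨x, y⟩ ⟨hx, hy⟩
    obtain ⟨a, -, ha⟩ := Real.ofDigits_SurjOn hq hx
    obtain ⟨b, -, hb⟩ := Real.ofDigits_SurjOn hq hy
    exact ⟨(a, b), Prod.ext ha hb⟩
  refine le_trans (le_of_eq ?_) (dimH_mono hsub)
  rw [Real.dimH_of_nonempty_interior]
  · simp
  · rw [interior_prod_eq, interior_Icc]
    exact ⟨(1 / 2, 1 / 2), by constructor <;> constructor <;> norm_num⟩

/-- If `c` and `d` first differ at `i`, the codes are at least `β ^ (-m (i + 2))` apart, while `a`
and `b` share `N i` digits and are within `q ^ (-N i) ≤ β ^ (-m (r i - C))`. -/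
lemma abs_ofDigits_sub_le_rpow (hβ : 1 < β) {m q : ℕ} (hm : m ≠ 0) {r r' C : ℝ} (hr : 0 < r)
    (hr' : 0 < r') (hq : β ^ (m * r') ≤ q) {N : ℕ → ℕ} (hN : ∀ i : ℕ, r * i - C ≤ r' * N i)
    {c d : ℕ → ℝ} (hc : ∀ i, IsLetter β m (c i)) (hd : ∀ i, IsLetter β m (d i))
    {a b : ℕ → Fin q} (h : ∀ i, (∀ j < i, c j = d j) → ∀ k < N i, a k = b k) :
    |Real.ofDigits a - Real.ofDigits b| ≤
      β ^ (m * (2 * r + C)) * |code β m c - code β m d| ^ r := by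
  classical
  have h0 : 0 < β := by linarith
  by_cases hcd : ∀ j, c j = d j
  · have hab : a = b := by
      funext k
      obtain ⟨i, hi⟩ := exists_nat_gt ((r' * k + C) / r)
      rw [div_lt_iff₀ hr] at hi
      refine h i (fun j _ => hcd j) k ?_
      have : r' * k < r' * N i := by linarith [hN i]
      exact_mod_cast lt_of_mul_lt_mul_left this hr'.le
    rw [hab, sub_self, abs_zero]; positivity
  · push Not at hcd
    set i := Nat.find hcd
    have hi : c i ≠ d i := Nat.find_spec hcd
    have hlt : ∀ j < i, c j = d j := fun j hj => not_not.1 (Nat.find_min hcd hj)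
    have hq0 : (0 : ℝ) < q := lt_of_lt_of_le (by positivity) hq
    calc |Real.ofDigits a - Real.ofDigits b| ≤ ((q : ℝ) ^ N i)⁻¹ :=
          Real.abs_ofDigits_sub_ofDigits_le (h i hlt)
      _ ≤ ((β ^ (m * r')) ^ N i)⁻¹ := by gcongr
      _ = β ^ (-(m * (r' * N i))) := by
          rw [← Real.rpow_natCast, ← Real.rpow_mul h0.le, ← Real.rpow_neg h0.le]
          congr 1; ring
      _ ≤ β ^ (-(m * (r * i - C))) := by
          gcongr
          · exact hβ.le
          · exact hN i
      _ = β ^ (m * (2 * r + C)) * (1 / (β ^ m) ^ (i + 2)) ^ r := by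
          rw [one_div, ← pow_mul, ← Real.rpow_natCast, ← Real.rpow_neg h0.le,
            ← Real.rpow_mul h0.le, ← Real.rpow_add h0]
          congr 1; push_cast; ring
      _ ≤ β ^ (m * (2 * r + C)) * |code β m c - code β m d| ^ r := by
          gcongr
          exact le_abs_code_sub_code hβ hm hc hd hlt hi

/-- The pairs `(x, y)` coded by free letters, prefixes of the blocks of `y` being inserted into
those of `x`. -/
def insertionSet (β : ℝ) (m : ℕ) (P : ℕ → ℕ) : Set (ℝ × ℝ) :=
  {p | ∃ u v : ℕ → ℝ, (∀ i, IsLetter β m (u i) ∧ u i ≠ 0) ∧ (∀ i, IsLetter β m (v i) ∧ v i ≠ 0) ∧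
    p = (code β m (insertPrefixes P (withMarker v) u), code β m (withMarker v))}

lemma le_dimH_insertionSet (hβ : 1 < β) {m : ℕ} (hm : m ≠ 0) (h2 : 2 ≤ β ^ m) {P : ℕ → ℕ}
    (hpow : ∀ l, 5 ≤ l → 2 ^ l ≤ P l) {r : NNReal} {r' : ℝ} (hr : 0 < r)
    (hrr' : r < r') {A : Finset ℝ} (hA : ∀ c ∈ A, IsLetter β m c ∧ c ≠ 0)
    (hcard : β ^ (m * r') ≤ A.card) :
    r * 2 ≤ dimH (insertionSet β m P) := by
  have hr0 : (0 : ℝ) < r := by exact_mod_cast hr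
  have hr'0 : 0 < r' := hr0.trans hrr'
  have hq : 1 < A.card := by
    have : (1 : ℝ) < β ^ (m * r') := Real.one_lt_rpow hβ (by positivity)
    exact_mod_cast this.trans_le hcard
  set q := A.card
  let e : Fin q ≃ A := A.equivFin.symm
  have he : ∀ k, IsLetter β m (e k) ∧ (e k : ℝ) ≠ 0 := fun k => hA _ (e k).2
  have hinj : ∀ {k l}, (e k : ℝ) = e l → k = l := fun h => e.injective (Subtype.ext h)
  -- This `ε` gives `r' (1 - ε) = r`: the loss from `r'` to `r` pays for the overwritten places. The
  -- maximum below also covers the four marker letters.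
  obtain ⟨C, hC⟩ := exists_mul_le_freeCount hpow (ε := 1 - r / r')
    (by rw [sub_pos, div_lt_one hr'0]; exact hrr')
  have hNx : ∀ i : ℕ, r * i - max (r' * C) (4 * r') ≤ r' * (freeCount P i : ℝ) := by
    intro i
    have h1 := mul_le_mul_of_nonneg_left (hC i) hr'0.le
    have h2 : r' * ((1 - (1 - r / r')) * i - C) = r * i - r' * C := by field_simp; ring
    linarith [le_max_left (r' * C) (4 * r')]
  have hNy : ∀ i : ℕ, r * i - max (r' * C) (4 * r') ≤ r' * ((i - 4 : ℕ) : ℝ) := by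
    intro i
    have h1 : (i : ℝ) - 4 ≤ ((i - 4 : ℕ) : ℝ) := by
      rw [sub_le_iff_le_add]; norm_cast; omega
    have h2 := mul_le_mul_of_nonneg_left h1 hr'0.le
    have h3 : r * (i : ℝ) ≤ r' * i := by gcongr
    linarith [le_max_right (r' * C) (4 * r')]
  let Yv : (ℕ → Fin q) → ℕ → ℝ := fun v => withMarker fun i => e (v i)
  let Xu : (ℕ → Fin q) × (ℕ → Fin q) → ℕ → ℝ := fun p =>
    insertPrefixes P (Yv p.2) fun i => e (p.1 i)
  have hY : ∀ v i, IsLetter β m (Yv v i) := fun v =>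
    isLetter_withMarker hβ h2 fun i => (he _).1
  have hX : ∀ p i, IsLetter β m (Xu p i) := fun p =>
    isLetter_insertPrefixes hβ h2 (hY _) fun i => (he _).1
  let Φ : (ℕ → Fin q) × (ℕ → Fin q) → ℝ × ℝ := fun p => (code β m (Xu p), code β m (Yv p.2))
  have : Nonempty ((ℕ → Fin q) × (ℕ → Fin q)) :=
    ⟨(fun _ => ⟨0, by omega⟩, fun _ => ⟨0, by omega⟩)⟩
  let K : NNReal := ⟨β ^ (m * (2 * r + max (r' * C) (4 * r'))), by positivity⟩
  have hmain : ∀ s t, dist (Real.ofDigits s.1, Real.ofDigits s.2)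
      (Real.ofDigits t.1, Real.ofDigits t.2) ≤ K * dist (Φ s) (Φ t) ^ (r : ℝ) := by
    intro s t
    rw [Prod.dist_eq, Real.dist_eq, Real.dist_eq]
    refine max_le ?_ ?_
    · refine (abs_ofDigits_sub_le_rpow hβ hm hr0 hr'0 hcard hNx (hX s) (hX t) ?_).trans ?_
      · intro i hij k hk
        obtain ⟨j, hj, hfree, rfl⟩ := exists_freeCount_eq hk
        have := hij j hj
        simp only [Xu] at this
        rw [insertPrefixes_of_free hfree, insertPrefixes_of_free hfree] at this
        exact hinj this
      · change _ ≤ β ^ (m * (2 * r + max (r' * C) (4 * r'))) * _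
        gcongr
        exact le_max_left _ _
    · refine (abs_ofDigits_sub_le_rpow hβ hm hr0 hr'0 hcard hNy (hY s.2) (hY t.2) ?_).trans ?_
      · intro i hij k hk
        have := hij (k + 4) (by omega)
        simp only [Yv, withMarker, if_neg (show ¬ k + 4 < 4 by omega), Nat.add_sub_cancel] at this
        exact hinj this
      · change _ ≤ β ^ (m * (2 * r + max (r' * C) (4 * r'))) * _
        gcongr
        exact le_max_right _ _
  calc (r : ENNReal) * 2 ≤ r * dimH (range fun p : (ℕ → Fin q) × (ℕ → Fin q) =>
          (Real.ofDigits p.1, Real.ofDigits p.2)) := by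
        gcongr; exact two_le_dimH_range_ofDigits hq
    _ ≤ dimH (range Φ) := mul_dimH_range_le hr hmain
    _ ≤ dimH (insertionSet β m P) := dimH_mono <| by
        rintro _ ⟨p, rfl⟩
        exact ⟨_, _, fun i => he (p.1 i), fun i => he (p.2 i), rfl⟩

/-! ### A slow sequence accumulating exactly on `J` -/

lemma exists_lipschitz_retraction {J : Set ℝ} (hne : J.Nonempty) (hint : J.OrdConnected)
    (hclosed : IsClosed J) (hbdd : BddBelow J) :
    ∃ f : ℝ → ℝ, (∀ x, f x ∈ J) ∧ (∀ x ∈ J, f x = x) ∧ LipschitzWith 1 f := by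
  have ha := hclosed.csInf_mem hne hbdd
  by_cases hb : BddAbove J
  · refine ⟨fun x => max (sInf J) (min (sSup J) x), fun x => ?_, fun x hx => ?_,
      (LipschitzWith.id.const_min _).const_max _⟩
    · exact hint.out ha (hclosed.csSup_mem hne hb)
        ⟨le_max_left _ _, max_le (csInf_le hbdd (hclosed.csSup_mem hne hb)) (min_le_left _ _)⟩
    · beta_reduce
      rw [min_eq_right (le_csSup hb hx), max_eq_right (csInf_le hbdd hx)]
  · refine ⟨fun x => max (sInf J) x, fun x => ?_, fun x hx => max_eq_right (csInf_le hbdd hx),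
      LipschitzWith.id.const_max _⟩
    obtain ⟨y, hy, hxy⟩ := not_bddAbove_iff.1 hb (max (sInf J) x)
    exact hint.out ha hy ⟨le_max_left _ _, hxy.le⟩

/-- A slowly oscillating function whose oscillation is unbounded in both directions. -/
noncomputable def wave (t : ℝ) : ℝ := t * Real.sin (Real.log t)

lemma abs_wave_sub_le {s t : ℝ} (hs : 1 ≤ s) (ht : 1 ≤ t) : |wave t - wave s| ≤ 2 * |t - s| := by
  have hd : ∀ x ∈ Ici (1 : ℝ), HasDerivWithinAt wave
      (1 * Real.sin (Real.log x) + x * (Real.cos (Real.log x) * x⁻¹)) (Ici 1) x := by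
    intro x hx
    have hx0 : x ≠ 0 := by have : (1 : ℝ) ≤ x := hx; linarith
    exact ((hasDerivAt_id x).mul ((Real.hasDerivAt_log hx0).sin)).hasDerivWithinAt
  have := (convex_Ici (1 : ℝ)).norm_image_sub_le_of_norm_hasDerivWithin_le (C := 2) hd
    (fun x hx => ?_) hs ht
  · simpa only [Real.norm_eq_abs] using this
  · have hx0 : x ≠ 0 := by have : (1 : ℝ) ≤ x := hx; linarith
    have e : 1 * Real.sin (Real.log x) + x * (Real.cos (Real.log x) * x⁻¹) =
        Real.sin (Real.log x) + Real.cos (Real.log x) := by field_simp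
    rw [e, Real.norm_eq_abs]
    have h1 := Real.abs_sin_le_one (Real.log x)
    have h2 := Real.abs_cos_le_one (Real.log x)
    exact (abs_add_le _ _).trans (by linarith)

/-- Intermediate values between a trough `t₁`, where `wave t₁ = -t₁`, and the next peak `t₂`, where
`wave t₂ = t₂`. -/
lemma exists_wave_eq (τ M : ℝ) : ∃ t, M ≤ t ∧ 1 ≤ t ∧ wave t = τ := by
  obtain ⟨k, hk⟩ := exists_nat_gt (max M (max 1 |τ|))
  have hkM : M ≤ k := (le_max_left _ _).trans hk.le
  have hk1 : (1 : ℝ) ≤ k := ((le_max_left _ _).trans (le_max_right _ _)).trans hk.le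
  have hkτ : |τ| ≤ k := ((le_max_right _ _).trans (le_max_right _ _)).trans hk.le
  set t₁ := Real.exp (-(Real.pi / 2) + ((k + 1 : ℕ) : ℝ) * (2 * Real.pi)) with ht₁
  set t₂ := Real.exp (Real.pi / 2 + ((k + 1 : ℕ) : ℝ) * (2 * Real.pi)) with ht₂
  have hπ := Real.pi_gt_three
  have hkt₁ : (k : ℝ) ≤ t₁ := by
    have := Real.add_one_le_exp (-(Real.pi / 2) + ((k + 1 : ℕ) : ℝ) * (2 * Real.pi))
    push_cast at this ht₁
    rw [ht₁]
    nlinarith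
  have ht₁₂ : t₁ ≤ t₂ := Real.exp_le_exp.2 (by linarith)
  have hw₁ : wave t₁ = -t₁ := by
    rw [wave, ht₁, Real.log_exp, Real.sin_add_nat_mul_two_pi, Real.sin_neg, Real.sin_pi_div_two]
    ring
  have hw₂ : wave t₂ = t₂ := by
    rw [wave, ht₂, Real.log_exp, Real.sin_add_nat_mul_two_pi, Real.sin_pi_div_two, mul_one]
  have hcont : ContinuousOn wave (Icc t₁ t₂) := by
    refine continuousOn_id.mul (Real.continuous_sin.comp_continuousOn
      (Real.continuousOn_log.mono fun x hx => ?_))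
    have : t₁ ≤ x := hx.1
    simp only [mem_compl_iff, mem_singleton_iff]
    linarith
  obtain ⟨t, ht, rfl⟩ := intermediate_value_Icc ht₁₂ hcont
    (show τ ∈ Icc (wave t₁) (wave t₂) by
      rw [hw₁, hw₂]
      exact ⟨by linarith [neg_abs_le τ], by linarith [le_abs_self τ]⟩)
  exact ⟨t, by linarith [ht.1], by linarith [ht.1], rfl⟩

lemma log_succ_sub_log_le (n : ℕ) :
    Real.log ((n + 1 : ℕ) + 1) - Real.log (n + 1) ≤ 1 / (n + 1) := by
  have hn : (0 : ℝ) < n + 1 := by positivity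
  rw [← Real.log_div (by positivity) hn.ne']
  refine (Real.log_le_sub_one_of_pos (by positivity)).trans (le_of_eq ?_)
  push_cast; field_simp; ring

/-- A slowly varying sequence in the interval `J` accumulating at every point of `J`. -/
lemma exists_slow_sequence {J : Set ℝ} (hne : J.Nonempty) (hint : J.OrdConnected)
    (hclosed : IsClosed J) (hbdd : BddBelow J) {c : ℝ} (hc : 0 < c) :
    ∃ h : ℕ → ℝ, (∀ n, h n ∈ J) ∧ (∀ n : ℕ, |h (n + 1) - h n| ≤ c / (n + 1)) ∧
      ∀ τ ∈ J, MapClusterPt τ atTop h := by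
  obtain ⟨f, hfJ, hfid, hlip⟩ := exists_lipschitz_retraction hne hint hclosed hbdd
  have hf : ∀ x y, |f x - f y| ≤ |x - y| := fun x y => by
    simpa [Real.dist_eq] using hlip.dist_le_mul x y
  have hlog : ∀ n : ℕ, 0 ≤ Real.log ((n : ℝ) + 1) := fun n => Real.log_nonneg (by simp)
  have hmono : ∀ n : ℕ, Real.log ((n : ℝ) + 1) ≤ Real.log ((n + 1 : ℕ) + 1) := fun n =>
    Real.log_le_log (by positivity) (by push_cast; linarith)
  -- Both `f` and `log` keep increments small, and `wave` is 2-Lipschitz on `[1, ∞)`, where `1 + log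
  -- (n + 1)` lies; the factor `c / 2` cancels that 2.
  set h : ℕ → ℝ := fun n => f (c / 2 * wave (1 + Real.log (n + 1))) with hdef
  refine ⟨h, fun n => hfJ _, fun n => ?_, fun τ hτ => ?_⟩
  · refine (hf _ _).trans ?_
    rw [← mul_sub, abs_mul, abs_of_pos (by positivity)]
    have h1 := abs_wave_sub_le (s := 1 + Real.log ((n : ℝ) + 1))
      (t := 1 + Real.log ((n + 1 : ℕ) + 1)) (by linarith [hlog n]) (by linarith [hlog (n + 1)])
    rw [add_sub_add_left_eq_sub, abs_of_nonneg (sub_nonneg.2 (hmono n))] at h1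
    have h2 := log_succ_sub_log_le n
    have h3 : c / (n + 1) = c / 2 * (2 * (1 / (n + 1))) := by ring
    rw [h3]
    gcongr
    linarith
  · rw [mapClusterPt_iff_frequently]
    intro s hs
    obtain ⟨ε, hε, hsub⟩ := Metric.mem_nhds_iff.1 hs
    rw [frequently_atTop]
    intro N
    obtain ⟨K, hK⟩ := exists_nat_gt (c / ε)
    obtain ⟨t, htM, ht1, hwt⟩ :=
      exists_wave_eq (τ / (c / 2)) (1 + Real.log ((max N K : ℕ) + 1))
    have hexp : ((max N K : ℕ) : ℝ) + 1 ≤ Real.exp (t - 1) := by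
      rw [← Real.exp_log (show (0 : ℝ) < (max N K : ℕ) + 1 by positivity)]
      exact Real.exp_le_exp.2 (by linarith)
    -- With `n + 1 = ⌊exp (t - 1)⌋`, the argument `1 + log (n + 1)` is within `1 / (n + 1)` of `t`,
    -- and `n ≥ K` makes the error smaller than `ε`.
    obtain ⟨n, hn⟩ : ∃ n, ⌊Real.exp (t - 1)⌋₊ = n + 1 :=
      Nat.exists_eq_succ_of_ne_zero (Nat.floor_pos.2 (by
        have : (0 : ℝ) ≤ (max N K : ℕ) := by positivity
        linarith)).ne'
    have hnle : max N K ≤ n := by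
      have : max N K + 1 ≤ ⌊Real.exp (t - 1)⌋₊ := Nat.le_floor (by exact_mod_cast hexp)
      omega
    have hl1 : Real.log ((n : ℝ) + 1) ≤ t - 1 := by
      rw [Real.log_le_iff_le_exp (by positivity)]
      have := Nat.floor_le (Real.exp_pos (t - 1)).le
      rw [hn] at this; exact_mod_cast this
    have hl2 : t - 1 ≤ Real.log ((n + 1 : ℕ) + 1) := by
      rw [Real.le_log_iff_exp_le (by positivity)]
      have := (Nat.lt_floor_add_one (Real.exp (t - 1))).le
      rw [hn] at this; exact this
    refine ⟨n, (le_max_left _ _).trans hnle, hsub ?_⟩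
    rw [Metric.mem_ball, Real.dist_eq, ← hfid τ hτ]
    refine (hf _ _).trans_lt ?_
    have e : τ = c / 2 * wave t := by rw [hwt]; field_simp
    rw [e, ← mul_sub, abs_mul, abs_of_pos (by positivity)]
    have h1 := abs_wave_sub_le (s := t) (t := 1 + Real.log ((n : ℝ) + 1)) ht1
      (by linarith [hlog n])
    have h2 : |1 + Real.log ((n : ℝ) + 1) - t| ≤ 1 / (n + 1) := by
      rw [abs_le]
      constructor <;> linarith [log_succ_sub_log_le n]
    have h3 : (1 : ℝ) / (n + 1) < ε / c := by
      have : (K : ℝ) ≤ n := by exact_mod_cast (le_max_right _ _).trans hnle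
      rw [div_lt_div_iff₀ (by positivity) hc]
      rw [div_lt_iff₀ hε] at hK
      nlinarith
    calc c / 2 * |wave (1 + Real.log (n + 1)) - wave t|
        ≤ c / 2 * (2 * (1 / (n + 1))) := by gcongr; linarith
      _ = c * (1 / (n + 1)) := by ring
      _ < c * (ε / c) := by gcongr
      _ = ε := by field_simp

lemma tendsto_div_of_tendsto_sub {h : ℕ → ℝ}
    (hd : Tendsto (fun n => h (n + 1) - h n) atTop (nhds 0)) :
    Tendsto (fun n : ℕ => h n / n) atTop (nhds 0) := by
  have h1 := hd.cesaro
  have h2 : Tendsto (fun n : ℕ => h 0 / (n : ℝ)) atTop (nhds 0) :=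
    tendsto_const_nhds.div_atTop tendsto_natCast_atTop_atTop
  have := h1.add h2
  rw [add_zero] at this
  refine this.congr fun n => ?_
  rw [Finset.sum_range_sub]
  ring

/-! ### Insertion places and the waiting rate -/

/-- The place of the `l`-th insertion, chosen so that the waiting time for blocks of length `m l`
is about `exp (m l h l)`. -/
noncomputable def place (m : ℕ) (h : ℕ → ℝ) (l : ℕ) : ℕ := ⌊Real.exp (m * l * h l)⌋₊

section place
variable {m : ℕ} {h : ℕ → ℝ} {a : ℝ}

lemma two_mul_le_exponent (hma : 2 ≤ m * a) (ha : ∀ n, a ≤ h n) (l : ℕ) :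
    2 * (l : ℝ) ≤ m * l * h l := by
  have h1 : (m * a) * (l : ℝ) ≤ (m * h l) * l := by have := ha l; gcongr
  have : (0 : ℝ) ≤ l := by positivity
  nlinarith

lemma two_pow_le_place (hma : 2 ≤ m * a) (ha : ∀ n, a ≤ h n) (l : ℕ) : 2 ^ l ≤ place m h l := by
  refine Nat.le_floor ?_
  have h1 := two_mul_le_exponent hma ha l
  have h2 : (2 : ℝ) ≤ Real.exp 1 := by linarith [Real.add_one_le_exp 1]
  push_cast
  calc (2 : ℝ) ^ l ≤ Real.exp 1 ^ l := by gcongr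
    _ = Real.exp l := by rw [← Real.exp_nat_mul, mul_one]
    _ ≤ _ := Real.exp_le_exp.2 (by have : (0 : ℝ) ≤ l := by positivity
                                   linarith)

/-- The step bound lets `l * h l` grow by at least `a / 2`, so the exponent grows by at least `m * a
/ 2 ≥ 1` and its exponential at least doubles; that exponential is already at least `2 l + 1 ≥ l +
2`. -/
lemma separated_place (hma : 2 ≤ m * a) (ha : ∀ n, a ≤ h n)
    (hstep : ∀ n : ℕ, |h (n + 1) - h n| ≤ a / 2 / (n + 1)) : Separated (place m h) := by
  intro l hl
  refine Nat.le_floor ?_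
  have h1 := two_mul_le_exponent hma ha l
  have hl' : (5 : ℝ) ≤ l := by exact_mod_cast hl
  have hlip : (l : ℝ) * h l + a / 2 ≤ (l + 1) * h (l + 1) := by
    have h2 := (abs_le.1 (hstep l)).1
    have h3 : ((l : ℝ) + 1) * -(a / 2 / (l + 1)) ≤ (l + 1) * (h (l + 1) - h l) := by gcongr
    have h4 : ((l : ℝ) + 1) * -(a / 2 / (l + 1)) = -(a / 2) := by field_simp
    have := ha l
    linarith
  have hexp : (m : ℝ) * l * h l + 1 ≤ m * (l + 1 : ℕ) * h (l + 1) := by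
    have := mul_le_mul_of_nonneg_left hlip (Nat.cast_nonneg (α := ℝ) m)
    push_cast
    nlinarith
  have h2 : (2 : ℝ) ≤ Real.exp 1 := by linarith [Real.add_one_le_exp 1]
  have h3 := Real.add_one_le_exp ((m : ℝ) * l * h l)
  have h4 : (place m h l : ℝ) ≤ Real.exp (m * l * h l) := Nat.floor_le (Real.exp_pos _).le
  have h5 := Real.exp_le_exp.2 hexp
  rw [Real.exp_add] at h5
  have h6 : Real.exp (m * l * h l) * 2 ≤ Real.exp (m * l * h l) * Real.exp 1 := by gcongr
  push_cast at h5 ⊢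
  linarith

lemma exponent_sub_one_le_log_place (hma : 2 ≤ m * a) (ha : ∀ n, a ≤ h n) (l : ℕ) :
    m * l * h l - 1 ≤ Real.log (place m h l) := by
  have h1 := two_mul_le_exponent hma ha l
  have hl : (0 : ℝ) ≤ l := by positivity
  have hp : (1 : ℝ) ≤ place m h l := by
    exact_mod_cast Nat.one_le_two_pow.trans (two_pow_le_place hma ha l)
  have h2 : Real.exp (m * l * h l) < place m h l + 1 := Nat.lt_floor_add_one _
  have h3 : (2 : ℝ) ≤ Real.exp 1 := by linarith [Real.add_one_le_exp 1]
  rw [Real.le_log_iff_exp_le (by linarith), Real.exp_sub, div_le_iff₀ (Real.exp_pos 1)]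
  nlinarith

lemma log_place_le (hma : 2 ≤ m * a) (ha : ∀ n, a ≤ h n) (l : ℕ) :
    Real.log (place m h l) ≤ m * l * h l := by
  have hp : 0 < place m h l := (Nat.two_pow_pos l).trans_le (two_pow_le_place hma ha l)
  rw [Real.log_le_iff_le_exp (by exact_mod_cast hp)]
  exact Nat.floor_le (Real.exp_pos _).le

end place

lemma waitingRate_eq_of_waitingTime_eq {x y : ℝ} {n w : ℕ} (hw : w ≠ 0)
    (h : waitingTime β n x y = w) : waitingRate β x y n = ((Real.log w / n : ℝ) : EReal) := by
  rw [waitingRate, h, EReal.coe_div]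
  congr 1
  rw [ENat.toENNReal_coe, ENNReal.log_pos_real (by simpa using hw) (ENNReal.natCast_ne_top w)]
  simp

/-- On the insertion set the waiting rate follows the prescribed sequence `h`. -/
lemma exists_waitingRate_sub_tendsto (hβ : 1 < β) {m : ℕ} (hm : m ≠ 0) (h2 : 2 ≤ β ^ m)
    {h : ℕ → ℝ} {a : ℝ} (hma : 2 ≤ m * a) (ha0 : 0 < a) (ha : ∀ n, a ≤ h n)
    (hstep : ∀ n : ℕ, |h (n + 1) - h n| ≤ a / 2 / (n + 1)) {p : ℝ × ℝ}
    (hp : p ∈ insertionSet β m (place m h)) :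
    ∃ R : ℕ → ℝ, (∀ᶠ n in atTop, waitingRate β p.1 p.2 n = R n) ∧
      Tendsto (fun n => R n - h (n / m)) atTop (nhds 0) := by
  obtain ⟨u, v, hu, hv, rfl⟩ := hp
  have hm0 : 0 < m := by omega
  have hsep := separated_place hma ha hstep
  set x := code β m (insertPrefixes (place m h) (withMarker v) u)
  set y := code β m (withMarker v)
  have hW : ∀ n, 5 * m ≤ n → ∃ w : ℕ, w ≠ 0 ∧ waitingTime β n x y = w ∧
      m * place m h (n / m) ≤ w ∧ w ≤ m * place m h (n / m + 1) := by
    intro n hn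
    obtain ⟨h3, h4⟩ := waitingTime_bounds hβ hm h2 hsep hu hv hn
    obtain ⟨w, hw⟩ := ENat.ne_top_iff_exists.1 (ne_top_of_le_ne_top (ENat.natCast_ne_top _) h4)
    change _ ≤ waitingTime β n x y at h3
    change waitingTime β n x y ≤ _ at h4
    rw [← hw] at h3 h4
    have h5 : m * place m h (n / m) ≤ w := by exact_mod_cast h3
    have h6 : 0 < m * place m h (n / m) :=
      Nat.mul_pos hm0 ((Nat.two_pow_pos _).trans_le (two_pow_le_place hma ha _))
    exact ⟨w, by omega, hw.symm, h5, by exact_mod_cast h4⟩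
  choose! w hw0 hwW hwl hwu using hW
  refine ⟨fun n => Real.log (w n) / n, ?_, ?_⟩
  · filter_upwards [eventually_ge_atTop (5 * m)] with n hn
    exact waitingRate_eq_of_waitingTime_eq (hw0 n hn) (hwW n hn)
  have hdiv := Nat.tendsto_div_const_atTop hm
  have hd : Tendsto (fun n => h (n + 1) - h n) atTop (nhds 0) := by
    refine squeeze_zero_norm (fun n => by simpa using hstep n) ?_
    have := (tendsto_one_div_add_atTop_nhds_zero_nat (𝕜 := ℝ)).const_mul (a / 2)
    rw [mul_zero] at this
    exact this.congr fun n => by rw [mul_one_div]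
  have hq := tendsto_div_of_tendsto_sub hd
  have hq' : Tendsto (fun n : ℕ => h (n / m) / ((n / m : ℕ) : ℝ)) atTop (nhds 0) := hq.comp hdiv
  have hd' : Tendsto (fun n : ℕ => h (n / m + 1) - h (n / m)) atTop (nhds 0) := hd.comp hdiv
  have hc : ∀ c : ℝ, Tendsto (fun n : ℕ => c / (n : ℝ)) atTop (nhds 0) := fun c =>
    tendsto_const_nhds.div_atTop tendsto_natCast_atTop_atTop
  -- `h` may be unbounded; `h l / l → 0` follows from its vanishing increments.
  have hhn : Tendsto (fun n : ℕ => h (n / m) / (n : ℝ)) atTop (nhds 0) := by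
    refine squeeze_zero' (.of_forall fun n => ?_) ?_ hq'
    · have := ha0.le.trans (ha (n / m)); positivity
    · filter_upwards [eventually_ge_atTop m] with n hn
      have h5 : 0 < n / m := Nat.div_pos hn hm0
      have h6 : ((n / m : ℕ) : ℝ) ≤ n := by exact_mod_cast Nat.div_le_self n m
      have := ha0.le.trans (ha (n / m))
      gcongr
  have hlo : Tendsto (fun n : ℕ => -(m * (h (n / m) / n) + 1 / n)) atTop (nhds 0) := by
    simpa using ((hhn.const_mul (m : ℝ)).add (hc 1)).neg
  have hhi : Tendsto (fun n : ℕ => (h (n / m + 1) - h (n / m)) + Real.log m / n +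
      m * (h (n / m) / n + 1 / n * (h (n / m + 1) - h (n / m)))) atTop (nhds 0) := by
    simpa using (hd'.add (hc (Real.log m))).add
      ((hhn.add ((hc 1).mul hd')).const_mul (m : ℝ))
  refine tendsto_of_tendsto_of_tendsto_of_le_of_le' hlo hhi ?_ ?_
  · filter_upwards [eventually_ge_atTop (5 * m)] with n hn
    have hn0 : (0 : ℝ) < n := by exact_mod_cast (by omega : 0 < n)
    have hpp : (0 : ℝ) < place m h (n / m) := by
      exact_mod_cast (Nat.two_pow_pos _).trans_le (two_pow_le_place hma ha (n / m))
    have h5 : Real.log (place m h (n / m)) ≤ Real.log (w n) := by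
      refine Real.log_le_log hpp ?_
      exact_mod_cast (Nat.le_mul_of_pos_left _ hm0).trans (hwl n hn)
    have h6 := exponent_sub_one_le_log_place hma ha (n / m)
    have h7 : (n : ℝ) ≤ m * (n / m : ℕ) + m := by
      exact_mod_cast (Nat.lt_mul_div_succ n hm0).le
    have h8 := ha0.le.trans (ha (n / m))
    have h9 : ((n : ℝ) - m) * h (n / m) ≤ m * (n / m : ℕ) * h (n / m) := by
      gcongr; linarith
    have e : -(m * (h (n / m) / n) + 1 / n) =
        (((n : ℝ) - m) * h (n / m) - 1) / n - h (n / m) := by field_simp; ring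
    rw [e]
    gcongr
    linarith
  · filter_upwards [eventually_ge_atTop (5 * m)] with n hn
    have hn0 : (0 : ℝ) < n := by exact_mod_cast (by omega : 0 < n)
    have hpp : (0 : ℝ) < place m h (n / m + 1) := by
      exact_mod_cast (Nat.two_pow_pos _).trans_le (two_pow_le_place hma ha (n / m + 1))
    have hmr : (0 : ℝ) < m := by exact_mod_cast hm0
    have hw0' : (0 : ℝ) < w n := by exact_mod_cast Nat.pos_of_ne_zero (hw0 n hn)
    have h5 : Real.log (w n) ≤ Real.log m + Real.log (place m h (n / m + 1)) := by
      rw [← Real.log_mul hmr.ne' hpp.ne']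
      exact Real.log_le_log hw0' (by exact_mod_cast hwu n hn)
    have h6 := log_place_le hma ha (n / m + 1)
    have h7 : (m : ℝ) * (n / m : ℕ) ≤ n := by exact_mod_cast Nat.mul_div_le n m
    have h8 := ha0.le.trans (ha (n / m + 1))
    have h9 : (m : ℝ) * (n / m + 1 : ℕ) * h (n / m + 1) ≤ (n + m) * h (n / m + 1) := by
      push_cast
      gcongr; linarith
    have e : (h (n / m + 1) - h (n / m)) + Real.log m / n +
        m * (h (n / m) / n + 1 / n * (h (n / m + 1) - h (n / m))) =
        (Real.log m + (n + m) * h (n / m + 1)) / n - h (n / m) := by field_simp; ring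
    rw [e]
    gcongr
    linarith

/-! ### From `h` to the accumulation points of the rate -/

section cluster
variable {h R : ℕ → ℝ} {rate : ℕ → EReal} {m : ℕ} {J : Set ℝ}

/-- Along `n = m * k` the index `n / m` is exactly `k`, so no value of `h` is skipped. -/
lemma mapClusterPt_rate (hm : m ≠ 0) (hrate : ∀ᶠ n in atTop, rate n = R n)
    (hR : Tendsto (fun n => R n - h (n / m)) atTop (nhds 0)) {t : ℝ}
    (ht : MapClusterPt t atTop h) : MapClusterPt (t : EReal) atTop rate := by
  have hmul : Tendsto (fun k : ℕ => m * k) atTop atTop :=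
    tendsto_id.const_mul_atTop' (by omega)
  have h1 : MapClusterPt t atTop (R ∘ fun k : ℕ => m * k) := by
    rw [mapClusterPt_iff_frequently]
    intro s hs
    obtain ⟨ε, hε, hsub⟩ := Metric.mem_nhds_iff.1 hs
    have h2 := ht.frequently (Metric.ball_mem_nhds t (half_pos hε))
    have h3 := (hR.comp hmul).eventually (Metric.ball_mem_nhds 0 (half_pos hε))
    refine (h2.and_eventually h3).mono fun k ⟨h4, h5⟩ => hsub ?_
    simp only [Function.comp, Nat.mul_div_cancel_left k (Nat.pos_of_ne_zero hm), Metric.mem_ball,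
      Real.dist_eq, sub_zero] at h4 h5 ⊢
    calc |R (m * k) - t| = |(R (m * k) - h k) + (h k - t)| := by ring_nf
      _ ≤ |R (m * k) - h k| + |h k - t| := abs_add_le _ _
      _ < ε := by linarith
  have h2 : MapClusterPt t atTop R := h1.of_comp hmul
  have h3 : MapClusterPt (t : EReal) atTop (fun n => (R n : EReal)) :=
    h2.continuousAt_comp (f := fun s : ℝ => (s : EReal)) continuous_coe_real_ereal.continuousAt
  exact (Filter.EventuallyEq.mapClusterPt_iff hrate).2 h3

lemma mem_of_mapClusterPt_rate (hclosed : IsClosed J) (hJ : ∀ n, h n ∈ J)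
    (hrate : ∀ᶠ n in atTop, rate n = R n)
    (hR : Tendsto (fun n => R n - h (n / m)) atTop (nhds 0)) {t : ℝ}
    (ht : MapClusterPt (t : EReal) atTop rate) : t ∈ J := by
  rw [← hclosed.closure_eq, Metric.mem_closure_iff]
  intro ε hε
  have hnhds : Ioo ((t - ε / 2 : ℝ) : EReal) ((t + ε / 2 : ℝ) : EReal) ∈ nhds (t : EReal) :=
    Ioo_mem_nhds (by exact_mod_cast (by linarith)) (by exact_mod_cast (by linarith))
  have h3 := hR.eventually (Metric.ball_mem_nhds 0 (half_pos hε))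
  obtain ⟨n, h4, h5, h6⟩ := ((ht.frequently hnhds).and_eventually (hrate.and h3)).exists
  rw [h5] at h4
  have h7 : t - ε / 2 < R n := by exact_mod_cast h4.1
  have h8 : R n < t + ε / 2 := by exact_mod_cast h4.2
  rw [Real.dist_eq, sub_zero, abs_lt] at h6
  refine ⟨h (n / m), hJ _, ?_⟩
  rw [Real.dist_eq, abs_lt]
  constructor <;> linarith [h6.1, h6.2]

/-- For bounded `J` the rate eventually stays in a compact real interval, which excludes `±∞`. -/
lemma exists_eq_coe_of_mapClusterPt_rate (hb : Bornology.IsBounded J) (hJ : ∀ n, h n ∈ J)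
    (hrate : ∀ᶠ n in atTop, rate n = R n)
    (hR : Tendsto (fun n => R n - h (n / m)) atTop (nhds 0)) {z : EReal}
    (hz : MapClusterPt z atTop rate) : ∃ t : ℝ, z = t := by
  obtain ⟨B, hB⟩ := hb.exists_norm_le
  have h1 : ∀ᶠ n in atTop, rate n ∈ Icc ((-(B + 1) : ℝ) : EReal) ((B + 1 : ℝ) : EReal) := by
    filter_upwards [hrate, hR.eventually (Metric.ball_mem_nhds 0 one_pos)] with n h2 h3
    rw [Real.dist_eq, sub_zero, abs_lt] at h3
    have h4 := abs_le.1 (hB _ (hJ (n / m)))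
    rw [h2]
    constructor
    · exact_mod_cast (by linarith [h3.1, h4.1] : -(B + 1) ≤ R n)
    · exact_mod_cast (by linarith [h3.2, h4.2] : R n ≤ B + 1)
  have h2 : z ∈ Icc ((-(B + 1) : ℝ) : EReal) ((B + 1 : ℝ) : EReal) := by
    by_contra hzn
    have := hz.frequently (isClosed_Icc.isOpen_compl.mem_nhds hzn)
    obtain ⟨n, h3, h4⟩ := (this.and_eventually h1).exists
    exact h3 h4
  refine ⟨z.toReal, (EReal.coe_toReal ?_ ?_).symm⟩
  · rintro rfl; exact (EReal.coe_lt_top _).not_ge h2.2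
  · rintro rfl; exact (EReal.bot_lt_coe _).not_ge h2.1

end cluster

/-! ### Full dimension -/

/-- The pairs meeting both requirements on the accumulation points form a set of full dimension. -/
lemma two_le_dimH_of_accPoints (hβ : 1 < β) {J : Set ℝ} (hne : J.Nonempty)
    (hint : J.OrdConnected) (hclosed : IsClosed J) (hpos : J ⊆ Ioi 0) :
    2 ≤ dimH {p : ℝ × ℝ | p ∈ accLevelSet β J ∧ (BddAbove J → p ∈ extAccLevelSet β J)} := by
  have hbdd : BddBelow J := ⟨0, fun x hx => (hpos hx).le⟩
  have haJ := hclosed.csInf_mem hne hbdd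
  set a := sInf J
  have ha0 : 0 < a := hpos haJ
  obtain ⟨h, hJ, hstep, hcl⟩ := exists_slow_sequence hne hint hclosed hbdd (half_pos ha0)
  have ha : ∀ n, a ≤ h n := fun n => csInf_le hbdd (hJ n)
  have key : ∀ r : NNReal, 0 < r → r < 1 → (r : ENNReal) * 2 ≤
      dimH {p : ℝ × ℝ | p ∈ accLevelSet β J ∧ (BddAbove J → p ∈ extAccLevelSet β J)} := by
    intro r hr hr1
    obtain ⟨r', hrr', hr'1⟩ := exists_between (show (r : ℝ) < 1 by exact_mod_cast hr1)
    have h1 := eventually_exists_letters hβ hr'1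
    have h2 := (tendsto_pow_atTop_atTop_of_one_lt hβ).eventually_ge_atTop 2
    have h3 := ((tendsto_natCast_atTop_atTop (R := ℝ)).atTop_mul_const ha0).eventually_ge_atTop 2
    -- Only `m` and the alphabet depend on `r`; `h` is fixed beforehand. `2 ≤ β ^ m` makes `0` a
    -- letter, and `2 ≤ m * a` makes the places grow and separate.
    obtain ⟨m, ⟨A, hA, hcard⟩, h2, hma, hm⟩ :=
      (h1.and (h2.and (h3.and (eventually_ge_atTop 1)))).exists
    have hm0 : m ≠ 0 := by omega
    refine (le_dimH_insertionSet hβ hm0 h2 (fun l _ => two_pow_le_place hma ha l) hr hrr' hA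
      hcard).trans (dimH_mono fun p hp => ?_)
    obtain ⟨R, hrate, hR⟩ := exists_waitingRate_sub_tendsto hβ hm0 h2 hma ha0 ha hstep hp
    have hmem : p.1 ∈ Ico (0 : ℝ) 1 ∧ p.2 ∈ Ico (0 : ℝ) 1 := by
      obtain ⟨u, v, hu, hv, rfl⟩ := hp
      have hY := isLetter_withMarker hβ h2 fun i => (hv i).1
      exact ⟨code_mem hβ hm0 (isLetter_insertPrefixes hβ h2 hY fun i => (hu i).1),
        code_mem hβ hm0 hY⟩
    refine ⟨⟨hmem.1, hmem.2, ?_⟩, fun hb => ⟨hmem.1, hmem.2, ?_⟩⟩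
    · ext t
      exact ⟨fun ht => mem_of_mapClusterPt_rate hclosed hJ hrate hR ht,
        fun ht => mapClusterPt_rate hm0 hrate hR (hcl t ht)⟩
    · ext z
      constructor
      · intro hz
        obtain ⟨t, rfl⟩ := exists_eq_coe_of_mapClusterPt_rate
          (isBounded_iff_bddBelow_bddAbove.2 ⟨hbdd, hb⟩) hJ hrate hR hz
        exact ⟨t, mem_of_mapClusterPt_rate hclosed hJ hrate hR hz, rfl⟩
      · rintro ⟨t, ht, rfl⟩
        exact mapClusterPt_rate hm0 hrate hR (hcl t ht)
  refine le_of_forall_lt fun d hd => ?_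
  lift d to NNReal using hd.ne_top
  have hd' : d < 2 := by exact_mod_cast hd
  obtain ⟨e, hde, he⟩ := exists_between hd'
  have he2 : e / 2 * 2 = e := div_mul_cancel₀ e two_ne_zero
  have := key (e / 2) (div_pos (pos_of_gt hde) two_pos) ((div_lt_one two_pos).2 he)
  calc (d : ENNReal) < e := by exact_mod_cast hde
    _ = ((e / 2 : NNReal) : ENNReal) * 2 := by exact_mod_cast he2.symm
    _ ≤ _ := this

lemma dimH_le_two (S : Set (ℝ × ℝ)) : dimH S ≤ 2 := by
  refine (dimH_mono (subset_univ S)).trans (le_of_eq ?_)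
  rw [Real.dimH_univ_eq_finrank]
  simp

end BetaExpansion

theorem mainTheorem3 (β : ℝ) (hβ : 1 < β) (J : Set ℝ) (hne : J.Nonempty)
    (hint : J.OrdConnected) (hclosed : IsClosed J) (hpos : J ⊆ Set.Ioi 0) :
    dimH (BetaExpansion.accLevelSet β J) = 2 ∧
      (BddAbove J → dimH (BetaExpansion.extAccLevelSet β J) = 2) := by
  have h := BetaExpansion.two_le_dimH_of_accPoints hβ hne hint hclosed hpos
  exact ⟨le_antisymm (BetaExpansion.dimH_le_two _) (h.trans (dimH_mono fun _ hp => hp.1)),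
    fun hb => le_antisymm (BetaExpansion.dimH_le_two _) (h.trans (dimH_mono fun _ hp => hp.2 hb))⟩
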